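/- Throughout, $K$ is a field of characteristic $0$, $\overline K$ is an algebraic closure of $K$, and $f\in K[x_1,\dots,x_n]$ is a nonzero polynomial of degree $d$ which is accessible only through a black box: on input $x\in\overline K^{\,n}$ it returns $f(x)$. A factorization of $f$ (over $\overline K$) is an expression $$f=\lambda\, l_1^{\alpha_1}\cdots l_k^{\alpha_k}$$ where $\lambda$ is a constant, the $l_i$ are nonzero linear forms, no two of which are proportional, and the $\alpha_i\ge 1$ are integers. \textbf{The hyperplane algorithm} (input: $n$, $d$, the black box for $f$, and a finite nonempty set $S\subseteq K$). \begin{enumerate} \item Pick $a\in S^n$ and $v_1,\dots,v_{n-1}\in S^n$ (a single vector $v_1$ if $n\le 1$), with all coordinates independent and uniform in $S$. For each $i$ compute $g_i(t)=f(a+tv_i)$ by interpolation from its values at $t=0,1,\dots,d$, and compute the roots of $g_i$ in $\overline K$. \item Form the list of all points $a+tv_i$ where $t$ is a root of $g_i$. Let $k$ be the number of distinct roots of $g_1$. \item Take the first point $p$ of the list, and find all the other points $q$ of the list such that the line $(pq)$ is included in the zero set of $f$; this is tested by checking that $f(tp+(1-t)q)=0$ for $t=2,\dots,k$. \item Let $H$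 be the span of $p$ and of the points $q$ found, and let $l$ be a nonzero linear form vanishing on $H$. Remove these points from the list and repeat steps 3 and 4 until the list is empty. This yields linear forms $l_1,l_2,\dots$. \item For each $l_j$ let $\alpha_j$ be the multiplicity, as a root of $g_1$, of the parameter $t$ such that $a+tv_1$ lies on the hyperplane $l_j=0$. \item Pick $r\in S^n$ with independent uniform coordinates, call the black box at $r$, set $\lambda=f(r)/\prod_j l_j(r)^{\alpha_j}$, and output $\lambda$, the forms $l_j$ and the exponents $\alpha_j$. \end{enumerate} (If a step is not well defined on a degenerate choice of $a,v_i,r$, a default value is used: $l=0$ if no nonzero form vanishes on $H$, $\alpha_j$ is the sum of the multiplicities of all roots $t$ with $l_j(a+tv_1)=0$, division by $0$ gives $0$, and the zero polynomial has no roots.) \textbf{Theorem.} There are polynomials $N(n,d)$, $P(n,d)$ and $B(n,d,s,\sigma)$ with nonnegative integer coefficients, which do not depend on any other data, such that the following holds. (1) Let $K$, $n$, $d$ and $f$ be as above, and assume that $f$ admits a factorization over $\overline K$. Then for every finite nonempty set $S\subseteq K$ the hyperplane algorithm outputs a factorization of $f$ with probability at least $1-N(n,d)/|S|$, and for all random choices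 it makes at most $P(n,d)$ calls to the black box for $f$. (2) Assume moreover that $K=\mathbb Q$ and that $f$ admits a factorization in which the $l_i$ have rational coefficients of bit size at most $s$. Let $m\ge 1$ be an integer and take $S=\{0,1,\dots,m\,N(n,d)\}$. Then the hyperplane algorithm outputs a factorization of $f$ with probability at least $1-1/m$, and for all random choices all its calls to the black box are made at rational points of bit size at most $B(n,d,s,\sigma)$, where $\sigma$ is the number of binary digits of $m$. Here the bit size of a rational number is the total binary length of its numerator and denominator in lowest terms plus one sign bit, and the bit size of a rational point is the sum of the bit sizes of its coordinates. -/

import Mathlib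

universe u v w w'

/-- A deterministic program with access to a black box `X → Y`: it either stops with a result, or
calls the black box at a point `x : X` and continues according to the answer. -/
inductive BlackBox (X : Type u) (Y : Type v) (α : Type w) : Type (max u v w)
  | done (result : α) : BlackBox X Y α
  | query (x : X) (next : Y → BlackBox X Y α) : BlackBox X Y α

namespace BlackBox

variable {X : Type u} {Y : Type v} {α : Type w} {β : Type w'}

/-- The result of the program when the black box is implemented by `o`. -/
def run (o : X → Y) : BlackBox X Y α → α
  | done a => a
  | query x next => run o (next (o x))

/-- The list of all points at which the program calls the black box, when the black box is
implemented by `o`. -/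
def calls (o : X → Y) : BlackBox X Y α → List X
  | done _ => []
  | query x next => x :: calls o (next (o x))

/-- Sequential composition. -/
def bind : BlackBox X Y α → (α → BlackBox X Y β) → BlackBox X Y β
  | done a, k => k a
  | query x next, k => query x fun y => bind (next y) k

/-- Call the black box once and return its answer. -/
def ask (x : X) : BlackBox X Y Y := query x done

/-- Execute the programs `F 0, …, F (m - 1)` one after the other and return their results. -/
def forFin : {m : ℕ} → (Fin m → BlackBox X Y α) → BlackBox X Y (Fin m → α)
  | 0, _ => done Fin.elim0
  | _ + 1, F => (F 0).bind fun a => (forFin fun i => F i.succ).bind fun as => done (Fin.cons a as)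

/-- Separate the elements of a list that pass a test from those that do not. -/
def partition (test : α → BlackBox X Y Bool) : List α → BlackBox X Y (List α × List α)
  | [] => done ([], [])
  | a :: as =>
    (test a).bind fun b => (partition test as).bind fun r =>
      done (if b then (a :: r.1, r.2) else (r.1, a :: r.2))

end BlackBox

/-- The linear form `c₁ x₁ + ⋯ + cₙ xₙ`. -/
noncomputable def linearForm {L : Type u} [Field L] {n : ℕ} (c : Fin n → L) :
    MvPolynomial (Fin n) L :=
  ∑ j, MvPolynomial.C (c j) * MvPolynomial.X j

/-- Data of a formal product `λ · l₁ ^ α₁ ⋯ l_k ^ α_k`: the constant `λ`, and the list of the pairs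
`(l_i, α_i)`, where `l_i` is given by its vector of coefficients. -/
structure LinearFactorization (n : ℕ) (L : Type u) where
  constant : L
  factors : List ((Fin n → L) × ℕ)

/-- `F` is a factorization over `L` of the polynomial `f` (with coefficients in the subfield `K`)
as a constant times a product of powers, with positive exponents, of nonzero linear forms no two of
which are proportional. -/
def LinearFactorization.IsFactorizationOf {K : Type u} {L : Type v} [Field K] [Field L]
    [Algebra K L] {n : ℕ} (F : LinearFactorization n L) (f : MvPolynomial (Fin n) K) : Prop :=
  (∀ p ∈ F.factors, p.1 ≠ 0 ∧ 1 ≤ p.2) ∧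
  F.factors.Pairwise (fun p q => ∀ c : L, p.1 ≠ c • q.1) ∧
  MvPolynomial.map (algebraMap K L) f =
    MvPolynomial.C F.constant * (F.factors.map fun p => linearForm p.1 ^ p.2).prod

namespace HyperplaneAlgorithm

variable {L : Type u} [Field L] {n : ℕ}

/-- Interpolation of `g(t) = f(a + t v)`, a polynomial of degree at most `d`, from its values at
`t = 0, 1, …, d`. -/
noncomputable def interpolateLine (d : ℕ) (a v : Fin n → L) :
    BlackBox (Fin n → L) L (Polynomial L) :=
  (BlackBox.forFin fun i : Fin (d + 1) => BlackBox.ask (a + ((i : ℕ) : L) • v)).bind fun ys =>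
    BlackBox.done (Lagrange.interpolate Finset.univ (fun i : Fin (d + 1) => ((i : ℕ) : L)) ys)

open Classical in
/-- The test whether the line through two points `p`, `q` of `Z(f)` is included in `Z(f)`: it
evaluates `g(t) = f(t p + (1 - t) q)` at the `k - 1` points `t = 2, …, k`
(`g(0) = g(1) = 0` is known). -/
noncomputable def lineTest (k : ℕ) (p q : Fin n → L) : BlackBox (Fin n → L) L Bool :=
  (BlackBox.forFin fun i : Fin (k - 1) =>
    BlackBox.ask ((((i : ℕ) + 2 : ℕ) : L) • p + (1 - (((i : ℕ) + 2 : ℕ) : L)) • q)).bind fun ys =>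
      BlackBox.done (decide (∀ i, ys i = 0))

/-- Take the first of the remaining points, collect with it all the remaining points that are joined
to it by a line included in `Z(f)`, remove them, and repeat until no point is left. The first
argument bounds the number of rounds; as every round removes a point, the length of the list is
enough. -/
noncomputable def groupPoints (k : ℕ) :
    ℕ → List (Fin n → L) → BlackBox (Fin n → L) L (List (List (Fin n → L)))
  | 0, _ => BlackBox.done []
  | _ + 1, [] => BlackBox.done []
  | rounds + 1, p :: rest =>
    (BlackBox.partition (lineTest k p) rest).bind fun r =>
      (groupPoints k rounds r.2).bind fun gs => BlackBox.done ((p :: r.1) :: gs)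

open Classical in
/-- The coefficients of a nonzero linear form that vanishes on the span of the given points
(`0` if there is none). -/
noncomputable def spanEquation (pts : List (Fin n → L)) : Fin n → L :=
  if h : ∃ l : Fin n → L, l ≠ 0 ∧ ∀ p ∈ pts, l ⬝ᵥ p = 0 then h.choose else 0

open Classical in
/-- The distinct points `a + t v i` where `t` is a root of `g i`, line after line. -/
noncomputable def intersectionPoints (a : Fin n → L) (v : Fin (n - 2 + 1) → Fin n → L)
    (g : Fin (n - 2 + 1) → Polynomial L) : List (Fin n → L) :=
  (List.finRange (n - 2 + 1)).flatMap fun i =>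
    (g i).roots.toFinset.toList.map fun t => a + t • v i

open Classical in
/-- The number of distinct roots of a univariate polynomial. -/
noncomputable def numRoots (g : Polynomial L) : ℕ := g.roots.toFinset.card

open Classical in
/-- The multiplicity, as a root of `g`, of the parameter `t` at which the line `a + t v` meets the
hyperplane `l = 0`. -/
noncomputable def multiplicityAt (g : Polynomial L) (a v l : Fin n → L) : ℕ :=
  g.roots.countP fun t => l ⬝ᵥ (a + t • v) = 0

/-- The hyperplane algorithm, for a polynomial of degree `d` in `n` variables given by a black box
on `Lⁿ`, as a function of the random base point `a`, of the random directions `v i` and of the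
random point `r` used for the normalization. There are `n - 1` directions when `n ≥ 2`
(and one direction when `n ≤ 1`, since the multiplicities are read off on the first line). -/
noncomputable def algorithm (d : ℕ) (a : Fin n → L) (v : Fin (n - 2 + 1) → Fin n → L)
    (r : Fin n → L) : BlackBox (Fin n → L) L (LinearFactorization n L) :=
  (BlackBox.forFin fun i => interpolateLine d a (v i)).bind fun g =>
    let points := intersectionPoints a v g
    (groupPoints (numRoots (g 0)) points.length points).bind fun groups =>
      let factors := groups.map fun pts =>
        (spanEquation pts, multiplicityAt (g 0) a (v 0) (spanEquation pts))
      (BlackBox.ask r).bind fun y =>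
        BlackBox.done ⟨y / (factors.map fun p => (p.1 ⬝ᵥ r) ^ p.2).prod, factors⟩

/-- The random choices of the algorithm: all the coordinates of `a`, of the `v i` and of `r` belong
to the finite set `S`. -/
abbrev Coins {K : Type u} (S : Finset K) (n : ℕ) : Type u :=
  (Fin n → S) × (Fin (n - 2 + 1) → Fin n → S) × (Fin n → S)

/-- The hyperplane algorithm over `L`, with random choices from a finite subset of the subfield
`K`. -/
noncomputable def program {K : Type u} (L : Type v) [Field K] [Field L] [Algebra K L]
    {S : Finset K} {n : ℕ} (d : ℕ) (ω : Coins S n) :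
    BlackBox (Fin n → L) L (LinearFactorization n L) :=
  algorithm d (fun j => algebraMap K L (ω.1 j)) (fun i j => algebraMap K L (ω.2.1 i j))
    (fun j => algebraMap K L (ω.2.2 j))

/-- The result of the algorithm on the polynomial `f`. -/
noncomputable def output {K : Type u} (L : Type v) [Field K] [Field L] [Algebra K L]
    {S : Finset K} {n : ℕ} (d : ℕ) (f : MvPolynomial (Fin n) K) (ω : Coins S n) :
    LinearFactorization n L :=
  (program L d ω).run fun x => MvPolynomial.aeval x f

/-- The points of `Lⁿ` at which the algorithm calls the black box for `f`. -/
noncomputable def queries {K : Type u} (L : Type v) [Field K] [Field L] [Algebra K L]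
    {S : Finset K} {n : ℕ} (d : ℕ) (f : MvPolynomial (Fin n) K) (ω : Coins S n) :
    List (Fin n → L) :=
  (program L d ω).calls fun x => MvPolynomial.aeval x f

end HyperplaneAlgorithm

/-- The probability of an event for the uniform distribution on a finite nonempty type. -/
noncomputable def uniformProb {Ω : Type u} (E : Set Ω) : ℝ := (E.ncard : ℝ) / (Nat.card Ω : ℝ)

/-- The bit size of a rational number: the total length in binary of its numerator and its
denominator, plus one bit for the sign. -/
def ratBitSize (q : ℚ) : ℕ := Nat.size q.num.natAbs + Nat.size q.den + 1

/-- The bit size of a rational point: the sum of the bit sizes of its coordinates. -/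
def pointBitSize {n : ℕ} (q : Fin n → ℚ) : ℕ := ∑ j, ratBitSize (q j)

/-- The set `{0, 1, …, N}` of rational numbers. -/
def ratInterval (N : ℕ) : Finset ℚ := (Finset.range (N + 1)).image fun i : ℕ => (i : ℚ)

/-! Restricted to a line `a + t v i`, the polynomial becomes `lam * ∏ j, ((c j ⬝ᵥ v i) t + c j ⬝ᵥ a)
^ α j`, of degree at most `d`, so interpolation recovers it exactly for every choice
(`run_interpolateLine_eq_lineProduct`). If the choices satisfy `IsGeneric`, each hyperplane gives
one root on each line, its multiplicity is the exponent, and each point found lies on exactly one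
hyperplane.

The line test then decides whether two points share a hyperplane: the product of the `k` distinct
forms has degree at most `k` along the line and vanishes at `k + 1` parameters, so one form vanishes
on the whole line (`run_lineTest_eq_true_iff`). The groups are therefore the hyperplanes.
Independence of `a` and the directions makes the points of one group determine their form up to a
scalar (`IsGeneric.exists_eq_smul`), and the value at `r` compensates for these scalars.

Genericity is the nonvanishing of a nonzero polynomial in the random coordinates, of degree bounded
in `n` and `d`; the Schwartz–Zippel lemma bounds the failure probability.

The bounds on calls and bit sizes need no genericity: the number of roots is bounded by the degree,
and every root comes from a nonconstant linear factor, so it is rational when the forms are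
(`exists_of_mem_roots_lineProduct`). -/

/-! ### Results and calls of composed programs. -/

namespace BlackBox

variable {X : Type*} {Y : Type*} {α : Type*} {β : Type*} (o : X → Y)

theorem run_bind (p : BlackBox X Y α) (k : α → BlackBox X Y β) :
    run o (p.bind k) = run o (k (run o p)) := by
  induction p with
  | done a => rfl
  | query x next ih => exact ih (o x)

theorem calls_bind (p : BlackBox X Y α) (k : α → BlackBox X Y β) :
    calls o (p.bind k) = calls o p ++ calls o (k (run o p)) := by
  induction p with
  | done a => rfl
  | query x next ih => simp [bind, calls, run, ih (o x)]

theorem run_forFin {m : ℕ} (F : Fin m → BlackBox X Y α) :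
    run o (forFin F) = fun i => run o (F i) := by
  induction m with
  | zero => exact funext fun i => i.elim0
  | succ m ih =>
    simp only [forFin, run_bind, ih, run]
    funext i
    refine Fin.cases ?_ (fun i => ?_) i <;> simp

theorem calls_forFin {m : ℕ} (F : Fin m → BlackBox X Y α) :
    calls o (forFin F) = (List.finRange m).flatMap fun i => calls o (F i) := by
  induction m with
  | zero => rfl
  | succ m ih =>
    simp [forFin, calls_bind, ih, calls, List.finRange_succ, List.flatMap_map]

theorem run_partition (test : α → BlackBox X Y Bool) (l : List α) :
    run o (partition test l) =
      (l.filter fun a => run o (test a), l.filter fun a => !run o (test a)) := by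
  induction l with
  | nil => rfl
  | cons a l ih =>
    simp only [partition, run_bind, run, ih]
    cases h : run o (test a) <;> simp [h]

theorem calls_partition (test : α → BlackBox X Y Bool) (l : List α) :
    calls o (partition test l) = l.flatMap fun a => calls o (test a) := by
  induction l with
  | nil => rfl
  | cons a l ih => simp [partition, calls_bind, calls, ih]

end BlackBox

/-! ### Interpolation, line test and grouping as programs. -/

namespace HyperplaneAlgorithm

open BlackBox

variable {L : Type*} [Field L] {n : ℕ} (o : (Fin n → L) → L)

theorem run_interpolateLine (d : ℕ) (a v : Fin n → L) :
    (interpolateLine d a v).run o =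
      Lagrange.interpolate Finset.univ (fun i : Fin (d + 1) => ((i : ℕ) : L))
        fun i => o (a + ((i : ℕ) : L) • v) := by
  simp [interpolateLine, run_bind, run_forFin, run, ask]

theorem calls_interpolateLine (d : ℕ) (a v : Fin n → L) :
    (interpolateLine d a v).calls o =
      (List.finRange (d + 1)).map fun i : Fin (d + 1) => a + ((i : ℕ) : L) • v := by
  simp only [interpolateLine, calls_bind, calls_forFin, calls, ask, List.append_nil]
  induction List.finRange (d + 1) <;> simp_all

open Classical in
theorem run_lineTest (k : ℕ) (p q : Fin n → L) :
    (lineTest k p q).run o = decide (∀ i : Fin (k - 1),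
      o ((((i : ℕ) + 2 : ℕ) : L) • p + (1 - (((i : ℕ) + 2 : ℕ) : L)) • q) = 0) := by
  simp [lineTest, run_bind, run_forFin, run, ask]

theorem calls_lineTest (k : ℕ) (p q : Fin n → L) :
    (lineTest k p q).calls o = (List.finRange (k - 1)).map fun i : Fin (k - 1) =>
      (((i : ℕ) + 2 : ℕ) : L) • p + (1 - (((i : ℕ) + 2 : ℕ) : L)) • q := by
  simp only [lineTest, calls_bind, calls_forFin, calls, ask, List.append_nil]
  induction List.finRange (k - 1) <;> simp_all

/-- Later rounds work on sublists of the initial list, so bit bounds for the initial points carry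
over to all tests. -/
theorem exists_of_mem_calls_groupPoints (k rounds : ℕ) (pts : List (Fin n → L)) {x : Fin n → L}
    (hx : x ∈ (groupPoints k rounds pts).calls o) :
    ∃ p ∈ pts, ∃ q ∈ pts, x ∈ (lineTest k p q).calls o := by
  induction rounds generalizing pts with
  | zero => simp [groupPoints, calls] at hx
  | succ rounds ih =>
    cases pts with
    | nil => simp [groupPoints, calls] at hx
    | cons p rest =>
      simp only [groupPoints, calls_bind, calls, List.append_nil, List.mem_append, run_partition,
        calls_partition, List.mem_flatMap] at hx
      rcases hx with ⟨q, hq, hx⟩ | hx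
      · exact ⟨p, by simp, q, by simp [hq], hx⟩
      · obtain ⟨p', hp', q', hq', h⟩ := ih _ hx
        exact ⟨p', List.mem_cons_of_mem _ (List.mem_of_mem_filter hp'), q',
          List.mem_cons_of_mem _ (List.mem_of_mem_filter hq'), h⟩

/-- The list only shrinks, so each round costs at most `k - 1` calls per point of the initial list.
-/
theorem length_calls_groupPoints_le (k rounds : ℕ) (pts : List (Fin n → L)) :
    ((groupPoints k rounds pts).calls o).length ≤ rounds * (pts.length * (k - 1)) := by
  induction rounds generalizing pts with
  | zero => simp [groupPoints, calls]
  | succ rounds ih =>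
    cases pts with
    | nil => simp [groupPoints, calls]
    | cons p rest =>
      simp only [groupPoints, calls_bind, calls, List.append_nil, List.length_append,
        run_partition, calls_partition, List.length_flatMap, calls_lineTest, List.length_map,
        List.length_finRange, List.map_const', List.sum_replicate, smul_eq_mul]
      have h1 := ih (rest.filter fun a => !(lineTest k p a).run o)
      have h2 : (rest.filter fun a => !(lineTest k p a).run o).length ≤ rest.length :=
        List.length_filter_le _ _
      have h3 : rounds * ((rest.filter fun a => !(lineTest k p a).run o).length * (k - 1)) ≤
          rounds * ((rest.length + 1) * (k - 1)) := by gcongr; omega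
      have h4 : rest.length * (k - 1) ≤ (rest.length + 1) * (k - 1) := by gcongr; omega
      have h5 : (rounds + 1) * ((rest.length + 1) * (k - 1)) =
          (rest.length + 1) * (k - 1) + rounds * ((rest.length + 1) * (k - 1)) := by ring
      rw [List.length_cons, h5]
      exact add_le_add h4 (h1.trans h3)

open Classical in
/-- If every point of the list belongs to exactly one class, and the line test decides whether two
points belong to the same class, then the groups are the nonempty classes. -/
theorem exists_run_groupPoints_eq {ι : Type*} (Z : ι → (Fin n → L) → Prop) (k rounds : ℕ)
    (pts : List (Fin n → L)) (hlen : pts.length ≤ rounds) (hZ : ∀ p ∈ pts, ∃! j, Z j p)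
    (htest : ∀ p ∈ pts, ∀ q ∈ pts, ((lineTest k p q).run o = true ↔ ∃ j, Z j p ∧ Z j q)) :
    ∃ js : List ι, js.Nodup ∧ (∀ j, j ∈ js ↔ ∃ p ∈ pts, Z j p) ∧
      (groupPoints k rounds pts).run o = js.map fun j => pts.filter fun p => Z j p := by
  induction rounds generalizing pts with
  | zero =>
    obtain rfl := List.length_eq_zero_iff.1 (Nat.le_zero.1 hlen)
    exact ⟨[], by simp, by simp, rfl⟩
  | succ rounds ih =>
    cases pts with
    | nil => exact ⟨[], by simp, by simp, rfl⟩
    | cons p rest =>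
      obtain ⟨i, hi, hi'⟩ := hZ p (by simp)
      -- Since `p` has a single class `i`, testing against `p` is the same as membership in `i`.
      have key : ∀ q ∈ rest, ((lineTest k p q).run o = true ↔ Z i q) := fun q hq => by
        rw [htest p (by simp) q (by simp [hq])]
        exact ⟨fun ⟨j, hj, hj'⟩ => hi' j hj ▸ hj', fun h => ⟨i, hi, h⟩⟩
      have huniq : ∀ q ∈ rest, ∀ j j', Z j q → Z j' q → j = j' := fun q hq j j' h h' =>
        (hZ q (by simp [hq])).unique h h'
      have e1 : (rest.filter fun a => (lineTest k p a).run o) = rest.filter fun q => Z i q :=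
        List.filter_congr fun q hq => by
          rw [Bool.eq_iff_iff, key q hq]; simp
      have e2 : (rest.filter fun a => !(lineTest k p a).run o) = rest.filter fun q => ¬ Z i q :=
        List.filter_congr fun q hq => by
          rw [Bool.eq_iff_iff]; simp [← key q hq]
      have hmem : ∀ q ∈ (rest.filter fun q => ¬ Z i q), q ∈ rest ∧ ¬ Z i q := fun q hq => by
        simpa using hq
      obtain ⟨js, hnd, hjs, hrun⟩ := ih (rest.filter fun q => ¬ Z i q)
        ((List.length_filter_le _ _).trans (by simpa using hlen))
        (fun q hq => hZ q (by simp [(hmem q hq).1]))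
        (fun q hq q' hq' => htest q (by simp [(hmem q hq).1]) q' (by simp [(hmem q' hq').1]))
      have hi_notMem : i ∉ js := fun h => by
        obtain ⟨q, hq, hq'⟩ := (hjs i).1 h
        exact (hmem q hq).2 hq'
      refine ⟨i :: js, List.nodup_cons.2 ⟨hi_notMem, hnd⟩, fun j => ?_, ?_⟩
      · constructor
        · intro h
          rcases List.mem_cons.1 h with rfl | h
          · exact ⟨p, by simp, hi⟩
          · obtain ⟨q, hq, hq'⟩ := (hjs j).1 h
            exact ⟨q, by simp [(hmem q hq).1], hq'⟩
        · rintro ⟨q, hq, hjq⟩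
          by_cases hji : j = i
          · simp [hji]
          · rcases List.mem_cons.1 hq with rfl | hq
            · exact absurd (hi' j hjq) hji
            · refine List.mem_cons_of_mem _ ((hjs j).2 ⟨q, ?_, hjq⟩)
              simpa using ⟨hq, fun h => hji (huniq q hq _ _ hjq h)⟩
      · simp only [groupPoints, run_bind, run, run_partition, e1, e2, hrun, List.map_cons]
        congr 1
        · simp [hi]
        -- Classes are disjoint on the list, so removing class `i` first does not change the group
        -- of any other class `j`.
        · refine List.map_congr_left fun j hj => ?_
          have hji : j ≠ i := fun h => hi_notMem (h ▸ hj)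
          have hjp : ¬ Z j p := fun h => hji (hi' j h)
          rw [List.filter_cons_of_neg (by simpa using hjp), List.filter_filter]
          refine List.filter_congr fun q hq => ?_
          by_cases h : Z j q
          · have : ¬ Z i q := fun h' => hji (huniq q hq _ _ h h')
            simp [h, this]
          · simp [h]

theorem run_algorithm (d : ℕ) (a : Fin n → L) (v : Fin (n - 2 + 1) → Fin n → L) (r : Fin n → L) :
    (algorithm d a v r).run o =
      let g := fun i => (interpolateLine d a (v i)).run o
      let points := intersectionPoints a v g
      let factors := ((groupPoints (numRoots (g 0)) points.length points).run o).map fun pts =>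
        (spanEquation pts, multiplicityAt (g 0) a (v 0) (spanEquation pts))
      ⟨o r / (factors.map fun p => (p.1 ⬝ᵥ r) ^ p.2).prod, factors⟩ := by
  simp only [algorithm, run_bind, run_forFin, ask, run]

theorem calls_algorithm (d : ℕ) (a : Fin n → L) (v : Fin (n - 2 + 1) → Fin n → L)
    (r : Fin n → L) :
    (algorithm d a v r).calls o =
      let g := fun i => (interpolateLine d a (v i)).run o
      let points := intersectionPoints a v g
      ((List.finRange (n - 2 + 1)).flatMap fun i => (interpolateLine d a (v i)).calls o) ++
        ((groupPoints (numRoots (g 0)) points.length points).calls o ++ [r]) := by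
  simp only [algorithm, calls_bind, run_forFin, calls_forFin, ask, calls, List.append_nil]

theorem mem_intersectionPoints {a : Fin n → L} {v : Fin (n - 2 + 1) → Fin n → L}
    {g : Fin (n - 2 + 1) → Polynomial L} {p : Fin n → L} :
    p ∈ intersectionPoints a v g ↔ ∃ i, ∃ t ∈ (g i).roots, a + t • v i = p := by
  simp [intersectionPoints]

theorem length_intersectionPoints_le {a : Fin n → L} {v : Fin (n - 2 + 1) → Fin n → L}
    {g : Fin (n - 2 + 1) → Polynomial L} {d : ℕ} (hg : ∀ i, (g i).natDegree ≤ d) :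
    (intersectionPoints a v g).length ≤ (n - 2 + 1) * d := by
  classical
  simp only [intersectionPoints, List.length_flatMap, List.length_map, Finset.length_toList]
  refine (List.sum_le_card_nsmul _ d ?_).trans (by simp)
  intro x hx
  obtain ⟨i, -, rfl⟩ := List.mem_map.1 hx
  convert! (Multiset.toFinset_card_le _).trans ((Polynomial.card_roots' _).trans (hg i))

theorem spanEquation_spec {pts : List (Fin n → L)} {l : Fin n → L} (hl : l ≠ 0)
    (h : ∀ p ∈ pts, l ⬝ᵥ p = 0) :
    spanEquation pts ≠ 0 ∧ ∀ p ∈ pts, spanEquation pts ⬝ᵥ p = 0 := by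
  have hex : ∃ l : Fin n → L, l ≠ 0 ∧ ∀ p ∈ pts, l ⬝ᵥ p = 0 := ⟨l, hl, h⟩
  rw [spanEquation, dif_pos hex]
  exact hex.choose_spec

end HyperplaneAlgorithm

/-! ### Linear forms as polynomials. -/

section LinearForms

variable {L : Type*} [Field L] {n : ℕ}

theorem eval_linearForm (c x : Fin n → L) : MvPolynomial.eval x (linearForm c) = c ⬝ᵥ x := by
  simp [linearForm, dotProduct]

theorem linearForm_smul (u : L) (c : Fin n → L) :
    linearForm (u • c) = MvPolynomial.C u * linearForm c := by
  simp [linearForm, Finset.mul_sum, mul_assoc]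

theorem isHomogeneous_linearForm (c : Fin n → L) : (linearForm c).IsHomogeneous 1 :=
  MvPolynomial.IsHomogeneous.sum _ _ _ fun j _ => by
    simpa using (MvPolynomial.isHomogeneous_C (Fin n) (c j)).mul (MvPolynomial.isHomogeneous_X L j)

end LinearForms

theorem List.Nodup.prod_map_eq_prod_univ {ι M : Type*} [Fintype ι] [CommMonoid M] {js : List ι}
    (hnd : js.Nodup) (hall : ∀ j, j ∈ js) (G : ι → M) : (js.map G).prod = ∏ j, G j := by
  classical
  rw [← List.prod_toFinset G hnd]
  congr 1
  ext j
  simp [hall j]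

/-! ### Restriction of a product of linear forms to a line. -/

namespace HyperplaneAlgorithm

open BlackBox Polynomial

variable {L : Type*} [Field L] {n : ℕ} {ι : Type*}

section

variable [Fintype ι]

/-- The restriction of `lam * ∏ j, (c j ⬝ᵥ x) ^ α j` to the line `a + t v`, as a polynomial
in `t`. -/
noncomputable def lineProduct (lam : L) (c : ι → Fin n → L) (α : ι → ℕ) (a v : Fin n → L) : L[X] :=
  C lam * ∏ j, (C (c j ⬝ᵥ v) * X + C (c j ⬝ᵥ a)) ^ α j

theorem eval_lineProduct (lam : L) (c : ι → Fin n → L) (α : ι → ℕ) (a v : Fin n → L) (t : L) :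
    (lineProduct lam c α a v).eval t = lam * ∏ j, (c j ⬝ᵥ (a + t • v)) ^ α j := by
  simp only [lineProduct, eval_mul, eval_C, eval_prod, eval_pow, eval_add, eval_X, dotProduct_add,
    dotProduct_smul, smul_eq_mul]
  congr 1
  exact Finset.prod_congr rfl fun j _ => by ring

theorem natDegree_lineProduct_le (lam : L) (c : ι → Fin n → L) (α : ι → ℕ) (a v : Fin n → L) :
    (lineProduct lam c α a v).natDegree ≤ ∑ j, α j := by
  refine (natDegree_C_mul_le _ _).trans ((natDegree_prod_le _ _).trans ?_)
  refine Finset.sum_le_sum fun j _ => natDegree_pow_le.trans ?_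
  simpa using Nat.mul_le_mul_left (α j) (natDegree_linear_le (a := c j ⬝ᵥ v) (b := c j ⬝ᵥ a))

/-- A polynomial of degree at most `d` is determined by its values at `d + 1` nodes, which are
distinct in characteristic zero. No genericity enters, so this also serves the bounds valid for all
random choices. -/
theorem run_interpolateLine_eq_lineProduct [CharZero L] {o : (Fin n → L) → L} {lam : L}
    {c : ι → Fin n → L} {α : ι → ℕ} (ho : ∀ x, o x = lam * ∏ j, (c j ⬝ᵥ x) ^ α j) {d : ℕ}
    (hd : ∑ j, α j ≤ d) (a v : Fin n → L) :
    (interpolateLine d a v).run o = lineProduct lam c α a v := by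
  rw [run_interpolateLine]
  symm
  refine Lagrange.eq_interpolate_of_eval_eq _ (fun i _ j _ h => Fin.ext (Nat.cast_injective h)) ?_
    fun i _ => by rw [eval_lineProduct, ho]
  refine degree_le_natDegree.trans_lt ?_
  have := (natDegree_lineProduct_le lam c α a v).trans hd
  simp only [Finset.card_univ, Fintype.card_fin]
  exact_mod_cast Nat.lt_succ_of_le this

/-- If the vanishing factor had zero slope it would be identically zero, and so would the product;
but the zero polynomial has an empty root multiset. -/
theorem exists_of_mem_roots_lineProduct {lam : L} {c : ι → Fin n → L} {α : ι → ℕ}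
    {a v : Fin n → L} {t : L} (ht : t ∈ (lineProduct lam c α a v).roots) :
    ∃ j, α j ≠ 0 ∧ c j ⬝ᵥ v ≠ 0 ∧ t = -((c j ⬝ᵥ v)⁻¹ * (c j ⬝ᵥ a)) := by
  have h0 := ne_zero_of_mem_roots ht
  have h1 : (lineProduct lam c α a v).eval t = 0 := (mem_roots h0).1 ht
  rw [lineProduct] at h0
  have hlam : lam ≠ 0 := by rintro rfl; simp at h0
  rw [eval_lineProduct, mul_eq_zero, or_iff_right hlam, Finset.prod_eq_zero_iff] at h1
  obtain ⟨j, -, hj⟩ := h1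
  have hα : α j ≠ 0 := fun h => by simp [h] at hj
  have hj := pow_eq_zero_iff hα |>.1 hj
  rw [dotProduct_add, dotProduct_smul, smul_eq_mul] at hj
  have hv : c j ⬝ᵥ v ≠ 0 := fun h => by
    refine h0 (mul_eq_zero_of_right _ (Finset.prod_eq_zero (Finset.mem_univ j) ?_))
    have h' : c j ⬝ᵥ a = 0 := by simpa [h] using hj
    simp [h, h', hα]
  refine ⟨j, hα, hv, ?_⟩
  field_simp
  linear_combination hj

theorem roots_lineProduct {lam : L} (hlam : lam ≠ 0) {c : ι → Fin n → L} (α : ι → ℕ)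
    {a v : Fin n → L} (hv : ∀ j, c j ⬝ᵥ v ≠ 0) :
    (lineProduct lam c α a v).roots =
      ∑ j, α j • ({-((c j ⬝ᵥ v)⁻¹ * (c j ⬝ᵥ a))} : Multiset L) := by
  have hne : ∀ j, C (c j ⬝ᵥ v) * X + C (c j ⬝ᵥ a) ≠ 0 := fun j h => hv j <| by
    simpa using congrArg (coeff · 1) h
  rw [lineProduct, roots_C_mul _ hlam,
    roots_prod _ _ (Finset.prod_ne_zero_iff.2 fun j _ => pow_ne_zero _ (hne j))]
  change ∑ j, _ = _
  refine Finset.sum_congr rfl fun j _ => ?_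
  rw [roots_pow]
  exact congrArg _ (roots_C_mul_X_add_C_of_IsUnit (c j ⬝ᵥ a) (Units.mk0 _ (hv j)))

end

/-! ### Generic choices. -/

/-- The square matrix with rows `a, v 0, …, v (n - 2)`. -/
def choiceMatrix {R : Type*} (a : Fin n → R) (v : Fin (n - 2 + 1) → Fin n → R) :
    Matrix (Fin n) (Fin n) R :=
  Matrix.of fun i => if h : (i : ℕ) = 0 then a else v ⟨i - 1, by omega⟩

/-- Random choices for which the algorithm recovers the forms `c j`. -/
structure IsGeneric (c : ι → Fin n → L) (a : Fin n → L) (v : Fin (n - 2 + 1) → Fin n → L)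
    (r : Fin n → L) : Prop where
  base : ∀ j, c j ⬝ᵥ a ≠ 0
  direction : ∀ i j, c j ⬝ᵥ v i ≠ 0
  separated : ∀ i j j', j ≠ j' →
    (c j ⬝ᵥ v i) * (c j' ⬝ᵥ a) - (c j ⬝ᵥ a) * (c j' ⬝ᵥ v i) ≠ 0
  det : (choiceMatrix a v).det ≠ 0
  normalization : ∀ j, c j ⬝ᵥ r ≠ 0

/-- The vector `w` is orthogonal to all rows of an invertible matrix. For `n ≤ 1` the direction `v
0` is not a row, which does no harm. -/
theorem eq_zero_of_dotProduct_eq_zero {a : Fin n → L} {v : Fin (n - 2 + 1) → Fin n → L}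
    (hdet : (choiceMatrix a v).det ≠ 0) {w : Fin n → L} (ha : w ⬝ᵥ a = 0)
    (hv : ∀ i, w ⬝ᵥ v i = 0) : w = 0 := by
  refine Matrix.eq_zero_of_mulVec_eq_zero hdet (funext fun i => ?_)
  rw [Matrix.mulVec, dotProduct_comm]
  by_cases h : (i : ℕ) = 0
  · simpa [choiceMatrix, h] using ha
  · simpa [choiceMatrix, h] using hv _

/-- The point where the line `a + t v` meets the hyperplane `l = 0`. -/
def meet (l a v : Fin n → L) : Fin n → L := a + (-((l ⬝ᵥ v)⁻¹ * (l ⬝ᵥ a))) • v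

/-- Multiplying by `l ⬝ᵥ v` turns incidence into the vanishing of a 2×2 minor, polynomial in `a` and
`v`; this explains the form of `IsGeneric.separated`. -/
theorem dotProduct_meet_eq_zero_iff {l a v : Fin n → L} (hv : l ⬝ᵥ v ≠ 0) (w : Fin n → L) :
    w ⬝ᵥ meet l a v = 0 ↔ (l ⬝ᵥ v) * (w ⬝ᵥ a) - (l ⬝ᵥ a) * (w ⬝ᵥ v) = 0 := by
  rw [meet, dotProduct_add, dotProduct_smul, smul_eq_mul, ← mul_right_inj' hv, mul_zero]
  have : (l ⬝ᵥ v) * (w ⬝ᵥ a + -((l ⬝ᵥ v)⁻¹ * (l ⬝ᵥ a)) * (w ⬝ᵥ v)) =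
      (l ⬝ᵥ v) * (w ⬝ᵥ a) - (l ⬝ᵥ a) * (w ⬝ᵥ v) := by field_simp; ring
  rw [this]

namespace IsGeneric

variable {c : ι → Fin n → L} {a : Fin n → L} {v : Fin (n - 2 + 1) → Fin n → L} {r : Fin n → L}

theorem dotProduct_meet_eq_zero_iff (h : IsGeneric c a v r) (i : Fin (n - 2 + 1)) (j j' : ι) :
    c j' ⬝ᵥ meet (c j) a (v i) = 0 ↔ j' = j := by
  rw [HyperplaneAlgorithm.dotProduct_meet_eq_zero_iff (h.direction i j)]
  constructor
  · intro h0
    by_contra hne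
    exact h.separated i j j' (Ne.symm hne) h0
  · rintro rfl
    ring

/-- The combination `(c j ⬝ᵥ a) • l - (l ⬝ᵥ a) • c j` kills `a` by construction, and incidence at
each point says that it kills `v i`. Hence it is zero, and `c j ⬝ᵥ a ≠ 0` allows division. -/
theorem exists_eq_smul (h : IsGeneric c a v r) (j : ι) {l : Fin n → L} (hl : l ≠ 0)
    (hmeet : ∀ i, l ⬝ᵥ meet (c j) a (v i) = 0) : ∃ u : L, u ≠ 0 ∧ l = u • c j := by
  have hw : (c j ⬝ᵥ a) • l - (l ⬝ᵥ a) • c j = 0 := by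
    refine eq_zero_of_dotProduct_eq_zero h.det ?_ fun i => ?_
    · simp only [sub_dotProduct, smul_dotProduct, smul_eq_mul]; ring
    · have := (HyperplaneAlgorithm.dotProduct_meet_eq_zero_iff (h.direction i j) l).1 (hmeet i)
      simp only [sub_dotProduct, smul_dotProduct, smul_eq_mul]
      linear_combination -this
  have hl' : l = ((c j ⬝ᵥ a)⁻¹ * (l ⬝ᵥ a)) • c j := by
    rw [mul_smul, ← sub_eq_zero.1 hw, inv_smul_smul₀ (h.base j)]
  refine ⟨_, fun h0 => hl ?_, hl'⟩
  rw [hl', h0, zero_smul]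

/-- Equal parameters would give one point of the line on two of the hyperplanes. -/
theorem roots_injective (h : IsGeneric c a v r) (i : Fin (n - 2 + 1)) :
    Function.Injective fun j => -((c j ⬝ᵥ v i)⁻¹ * (c j ⬝ᵥ a)) := fun j j' hjj' =>
  (h.dotProduct_meet_eq_zero_iff i j' j).1 <| by
    rw [meet, ← show _ = -((c j' ⬝ᵥ v i)⁻¹ * c j' ⬝ᵥ a) from hjj', ← meet,
      h.dotProduct_meet_eq_zero_iff]

variable [Fintype ι] {lam : L} {α : ι → ℕ}

/-- The algorithm does not know the number of hyperplanes; this identifies it with the `k` used in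
the line test. -/
theorem numRoots_lineProduct (h : IsGeneric c a v r) (hlam : lam ≠ 0) (hα : ∀ j, 1 ≤ α j)
    (i : Fin (n - 2 + 1)) : numRoots (lineProduct lam c α a (v i)) = Fintype.card ι := by
  classical
  have : (lineProduct lam c α a (v i)).roots.toFinset =
      Finset.univ.image fun j => -((c j ⬝ᵥ v i)⁻¹ * (c j ⬝ᵥ a)) := by
    ext t
    rw [roots_lineProduct hlam α (h.direction i)]
    simp [Multiset.mem_sum, Multiset.mem_nsmul, eq_comm, fun j => (Nat.one_le_iff_ne_zero.1 (hα j))]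
  rw [numRoots]
  convert congrArg Finset.card this
  rw [Finset.card_image_of_injective _ (h.roots_injective i), Finset.card_univ]

/-- Only the root contributed by `c j` lies on its hyperplane, so the count picks out a single
summand. The scalar `u` is allowed because forms are recovered only up to scaling. -/
theorem multiplicityAt_lineProduct (h : IsGeneric c a v r) (hlam : lam ≠ 0)
    (i : Fin (n - 2 + 1)) (j : ι) {u : L} (hu : u ≠ 0) :
    multiplicityAt (lineProduct lam c α a (v i)) a (v i) (u • c j) = α j := by
  classical
  rw [multiplicityAt, roots_lineProduct hlam α (h.direction i)]
  rw [← Multiset.coe_countPAddMonoidHom, map_sum, Finset.sum_eq_single j]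
  · have : c j ⬝ᵥ (a + -((c j ⬝ᵥ v i)⁻¹ * (c j ⬝ᵥ a)) • v i) = 0 :=
      (h.dotProduct_meet_eq_zero_iff i j j).2 rfl
    rw [map_nsmul, Multiset.coe_countPAddMonoidHom, ← Multiset.cons_zero,
      Multiset.countP_cons_of_pos _ (by rw [smul_dotProduct, this, smul_zero])]
    simp
  · intro j' _ hj'
    have : c j ⬝ᵥ (a + -((c j' ⬝ᵥ v i)⁻¹ * (c j' ⬝ᵥ a)) • v i) ≠ 0 := fun h0 =>
      hj' ((h.dotProduct_meet_eq_zero_iff i j' j).1 h0).symm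
    rw [map_nsmul, Multiset.coe_countPAddMonoidHom, ← Multiset.cons_zero,
      Multiset.countP_cons_of_neg _ (by
        rw [smul_dotProduct, smul_eq_mul]; exact mul_ne_zero hu this)]
    simp
  · simp

theorem mem_intersectionPoints_iff (h : IsGeneric c a v r) (hlam : lam ≠ 0) (hα : ∀ j, 1 ≤ α j)
    {p : Fin n → L} :
    p ∈ intersectionPoints a v (fun i => lineProduct lam c α a (v i)) ↔
      ∃ i j, meet (c j) a (v i) = p := by
  rw [mem_intersectionPoints]
  refine exists_congr fun i => ?_
  rw [roots_lineProduct hlam α (h.direction i)]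
  simp [Multiset.mem_sum, Multiset.mem_nsmul, meet, fun j => (Nat.one_le_iff_ne_zero.1 (hα j))]

end IsGeneric

/-! ### Correctness for generic choices. -/

variable [Fintype ι]

open Classical in
theorem run_lineTest_eq_true_iff [CharZero L] {o : (Fin n → L) → L} {lam : L}
    {c : ι → Fin n → L} {α : ι → ℕ} (ho : ∀ x, o x = lam * ∏ j, (c j ⬝ᵥ x) ^ α j)
    (hlam : lam ≠ 0) (hα : ∀ j, 1 ≤ α j) {p q : Fin n → L} (hp : ∃ j, c j ⬝ᵥ p = 0)
    (hq : ∃ j, c j ⬝ᵥ q = 0) :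
    (lineTest (Fintype.card ι) p q).run o = true ↔ ∃ j, c j ⬝ᵥ p = 0 ∧ c j ⬝ᵥ q = 0 := by
  have ho0 : ∀ x, o x = 0 ↔ ∃ j, c j ⬝ᵥ x = 0 := fun x => by
    rw [ho, mul_eq_zero, or_iff_right hlam, Finset.prod_eq_zero_iff]
    simp [fun j => (Nat.one_le_iff_ne_zero.1 (hα j))]
  rw [run_lineTest, decide_eq_true_iff]
  constructor
  · intro h
    -- The parameters 0 and 1 are the points `q` and `p` themselves; the values from 2 to `k` are
    -- those tested.
    have hline : ∀ s : Fin (Fintype.card ι + 1),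
        ∃ j, c j ⬝ᵥ (q + ((s : ℕ) : L) • (p - q)) = 0 := by
      rintro ⟨s, hs⟩
      match s, hs with
      | 0, _ => simpa using hq
      | 1, _ => simpa using hp
      | s + 2, hs =>
        obtain ⟨j, hj⟩ := (ho0 _).1 (h ⟨s, by omega⟩)
        refine ⟨j, ?_⟩
        rw [← hj]
        congr 1
        module
    -- All exponents are replaced by 1: this keeps the zeros and lowers the degree to at most `k`,
    -- so `k + 1` zeros suffice.
    have hzero : lineProduct 1 c (fun _ => 1) q (p - q) = 0 := by
      refine eq_zero_of_natDegree_lt_card_of_eval_eq_zero _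
        (f := fun s : Fin (Fintype.card ι + 1) => ((s : ℕ) : L))
        (fun i j h => Fin.ext (Nat.cast_injective h)) (fun s => ?_)
        ((natDegree_lineProduct_le _ _ _ _ _).trans_lt (by simp))
      obtain ⟨j, hj⟩ := hline s
      rw [eval_lineProduct, one_mul]
      exact Finset.prod_eq_zero (Finset.mem_univ j) (by rw [hj, pow_one])
    rw [lineProduct, C_1, one_mul, Finset.prod_eq_zero_iff] at hzero
    obtain ⟨j, -, hj⟩ := hzero
    rw [pow_one] at hj
    have h1 : c j ⬝ᵥ (p - q) = 0 := by simpa using congrArg (coeff · 1) hj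
    have h0 : c j ⬝ᵥ q = 0 := by simpa using congrArg (coeff · 0) hj
    exact ⟨j, by rwa [dotProduct_sub, h0, sub_zero] at h1, h0⟩
  · rintro ⟨j, hjp, hjq⟩ s
    exact (ho0 _).2 ⟨j, by simp [dotProduct_add, dotProduct_smul, hjp, hjq]⟩

theorem aeval_eq_of_map_eq {K : Type*} [Field K] [Algebra K L]
    {f : MvPolynomial (Fin n) K} {lam : L} {c : ι → Fin n → L} {α : ι → ℕ}
    (hf : MvPolynomial.map (algebraMap K L) f =
      MvPolynomial.C lam * ∏ j, linearForm (c j) ^ α j) (x : Fin n → L) :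
    MvPolynomial.aeval x f = lam * ∏ j, (c j ⬝ᵥ x) ^ α j := by
  rw [MvPolynomial.aeval_def, ← MvPolynomial.eval_map, hf]
  simp [eval_linearForm]

theorem IsGeneric.isFactorizationOf_run_algorithm {K : Type*} [Field K] [Algebra K L] [CharZero L]
    {c : ι → Fin n → L} {a : Fin n → L} {v : Fin (n - 2 + 1) → Fin n → L} {r : Fin n → L}
    (h : IsGeneric c a v r) {f : MvPolynomial (Fin n) K} {lam : L} {α : ι → ℕ}
    (hf : MvPolynomial.map (algebraMap K L) f =
      MvPolynomial.C lam * ∏ j, linearForm (c j) ^ α j)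
    (hlam : lam ≠ 0) (hα : ∀ j, 1 ≤ α j) {d : ℕ} (hd : ∑ j, α j ≤ d) :
    ((algorithm d a v r).run fun x => MvPolynomial.aeval x f).IsFactorizationOf f := by
  classical
  set o : (Fin n → L) → L := fun x => MvPolynomial.aeval x f
  have ho : ∀ x, o x = lam * ∏ j, (c j ⬝ᵥ x) ^ α j := aeval_eq_of_map_eq hf
  set pts := intersectionPoints a v fun i => lineProduct lam c α a (v i) with hpts
  have hmem : ∀ {p}, p ∈ pts ↔ ∃ i j, meet (c j) a (v i) = p :=
    h.mem_intersectionPoints_iff hlam hα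
  have hZ : ∀ p ∈ pts, ∃! j, c j ⬝ᵥ p = 0 := fun p hp => by
    obtain ⟨i, j, rfl⟩ := hmem.1 hp
    exact ⟨j, (h.dotProduct_meet_eq_zero_iff i j j).2 rfl,
      fun j' hj' => (h.dotProduct_meet_eq_zero_iff i j j').1 hj'⟩
  obtain ⟨js, hnd, hjs, hrun⟩ := exists_run_groupPoints_eq o (fun j p => c j ⬝ᵥ p = 0)
    (Fintype.card ι) pts.length pts le_rfl hZ fun p hp q hq =>
      run_lineTest_eq_true_iff ho hlam hα (hZ p hp).exists (hZ q hq).exists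
  -- The first line alone already meets every hyperplane.
  have hall : ∀ j, j ∈ js := fun j =>
    (hjs j).2 ⟨_, hmem.2 ⟨0, j, rfl⟩, (h.dotProduct_meet_eq_zero_iff 0 j j).2 rfl⟩
  set e : ι → Fin n → L := fun j => spanEquation (pts.filter fun p => c j ⬝ᵥ p = 0) with he
  have hcne : ∀ j, c j ≠ 0 := fun j h0 => h.base j (by rw [h0, zero_dotProduct])
  have hu : ∀ j, ∃ u : L, u ≠ 0 ∧ e j = u • c j := fun j => by
    have hspec := spanEquation_spec (pts := pts.filter fun p => c j ⬝ᵥ p = 0) (hcne j)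
      fun p hp => by simpa using (List.mem_filter.1 hp).2
    exact h.exists_eq_smul j hspec.1 fun i => hspec.2 _ <| List.mem_filter.2
      ⟨hmem.2 ⟨i, j, rfl⟩, by simpa using (h.dotProduct_meet_eq_zero_iff i j j).2 rfl⟩
  choose u hu0 hue using hu
  have hfac : (algorithm d a v r).run o =
      ⟨o r / ∏ j, (e j ⬝ᵥ r) ^ α j, js.map fun j => (e j, α j)⟩ := by
    rw [run_algorithm]
    simp only [run_interpolateLine_eq_lineProduct ho hd, h.numRoots_lineProduct hlam hα, ← hpts,
      hrun, List.map_map, Function.comp_def]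
    have hm : ∀ j, multiplicityAt (lineProduct lam c α a (v 0)) a (v 0) (e j) = α j := fun j => by
      rw [hue j, h.multiplicityAt_lineProduct hlam 0 j (hu0 j)]
    simp only [he] at hm ⊢
    simp only [hm, hnd.prod_map_eq_prod_univ hall]
  rw [hfac]
  refine ⟨?_, ?_, ?_⟩
  · intro p hp
    obtain ⟨j, -, rfl⟩ := List.mem_map.1 hp
    refine ⟨?_, hα j⟩
    change e j ≠ 0
    rw [hue j]
    exact smul_ne_zero (hu0 j) (hcne j)
  · rw [List.pairwise_map]
    refine hnd.imp_of_mem fun {j j'} _ _ hjj' x hx => ?_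
    change e j = x • e j' at hx
    have h1 : e j ⬝ᵥ meet (c j') a (v 0) = 0 := by
      rw [hx, hue j', smul_dotProduct, smul_dotProduct,
        (h.dotProduct_meet_eq_zero_iff 0 j' j').2 rfl, smul_zero, smul_zero]
    rw [hue j, smul_dotProduct, smul_eq_mul, mul_eq_zero, or_iff_right (hu0 j),
      h.dotProduct_meet_eq_zero_iff] at h1
    exact hjj' h1
  · have hU : ∏ j, u j ^ α j ≠ 0 := Finset.prod_ne_zero_iff.2 fun j _ => pow_ne_zero _ (hu0 j)
    have hR : ∏ j, (c j ⬝ᵥ r) ^ α j ≠ 0 :=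
      Finset.prod_ne_zero_iff.2 fun j _ => pow_ne_zero _ (h.normalization j)
    -- The recovered forms are `u j • c j`, so the constant must absorb the scalars; the values of
    -- the forms at `r` cancel because they are nonzero.
    have hconst : o r / ∏ j, (e j ⬝ᵥ r) ^ α j = lam / ∏ j, u j ^ α j := by
      simp only [ho, hue, smul_dotProduct, smul_eq_mul, mul_pow, Finset.prod_mul_distrib]
      field_simp
    simp only [List.map_map, Function.comp_def, hnd.prod_map_eq_prod_univ hall]
    rw [hconst]
    simp only [hue, linearForm_smul, mul_pow, Finset.prod_mul_distrib]
    rw [hf, ← mul_assoc]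
    simp only [← map_pow, ← map_prod, ← map_mul]
    rw [div_mul_cancel₀ _ hU]

end HyperplaneAlgorithm

/-! ### Uniform probability and the Schwartz–Zippel lemma. -/

section Probability

theorem uniformProb_le_of_equiv {Ω Ω' : Type*} [Finite Ω'] (φ : Ω ≃ Ω') {E : Set Ω} {E' : Set Ω'}
    (h : ∀ ω ∈ E, φ ω ∈ E') : uniformProb E ≤ uniformProb E' := by
  rw [uniformProb, uniformProb, Nat.card_congr φ]
  gcongr
  exact Set.ncard_le_ncard_of_injOn φ h φ.injective.injOn

/-- The Schwartz–Zippel lemma with variables indexed by a finite type, for evaluation points with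
coordinates in a finite subset of a subfield. -/
theorem uniformProb_eval_eq_zero_le {K L σ : Type*} [Field K] [Field L] [Algebra K L] [Fintype σ]
    {Q : MvPolynomial σ L} (hQ : Q ≠ 0) (S : Finset K) :
    uniformProb {ω : σ → S | MvPolynomial.eval (fun i => algebraMap K L (ω i)) Q = 0} ≤
      (Q.totalDegree : ℝ) / S.card := by
  classical
  let e := Fintype.equivFin σ
  -- The coefficients of `Q` lie in `L`, so the sample set is moved there; injectivity preserves its
  -- cardinality.
  let T : Finset L := S.image (algebraMap K L)
  have hT : T.card = S.card := Finset.card_image_of_injective _ (algebraMap K L).injective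
  have hQ' : MvPolynomial.renameEquiv L e Q ≠ 0 :=
    (map_ne_zero_iff _ (MvPolynomial.renameEquiv L e).injective).2 hQ
  have hsz := MvPolynomial.schwartz_zippel_totalDegree hQ' T
  rw [MvPolynomial.totalDegree_renameEquiv, hT] at hsz
  have hsz' := (NNRat.cast_le (K := ℝ)).2 hsz
  push_cast at hsz'
  refine le_trans ?_ hsz'
  rw [uniformProb, Nat.card_fun, Nat.card_eq_fintype_card, Nat.card_eq_fintype_card,
    Fintype.card_coe]
  push_cast
  gcongr
  rw [← Set.ncard_coe_finset]
  refine Set.ncard_le_ncard_of_injOn (fun ω i => algebraMap K L (ω (e.symm i))) ?_ ?_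
    (Finset.finite_toSet _)
  · intro ω hω
    simp only [Finset.coe_filter, Set.mem_ofPred_eq, Fintype.mem_piFinset]
    refine ⟨fun i => Finset.mem_image_of_mem _ (ω _).2, ?_⟩
    rw [MvPolynomial.renameEquiv_apply, MvPolynomial.eval_rename]
    simpa [Function.comp_def] using hω
  · intro ω _ ω' _ h
    funext i
    have h' := (algebraMap K L).injective (congrFun h (e i))
    rw [Equiv.symm_apply_apply] at h'
    exact Subtype.ext h'

end Probability

/-! ### Genericity as a nonvanishing polynomial condition. -/

namespace HyperplaneAlgorithm

variable {L : Type*} [Field L] {n : ℕ} {ι : Type*}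

open Classical in
/-- The product of all quantities that have to be nonzero for the choices to be generic. -/
noncomputable def genericityProduct {R : Type*} [CommRing R] [Fintype ι] (c : ι → Fin n → R)
    (a : Fin n → R) (v : Fin (n - 2 + 1) → Fin n → R) (r : Fin n → R) : R :=
  (∏ j, c j ⬝ᵥ a) * (∏ i, ∏ j, c j ⬝ᵥ v i) *
    (∏ i, ∏ j, ∏ j', if j = j' then 1 else
      (c j ⬝ᵥ v i) * (c j' ⬝ᵥ a) - (c j ⬝ᵥ a) * (c j' ⬝ᵥ v i)) *
    (choiceMatrix a v).det * ∏ j, c j ⬝ᵥ r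

theorem map_choiceMatrix {R T : Type*} (φ : R → T) (a : Fin n → R)
    (v : Fin (n - 2 + 1) → Fin n → R) :
    (choiceMatrix a v).map φ = choiceMatrix (φ ∘ a) fun i => φ ∘ v i := by
  ext i j
  by_cases h : (i : ℕ) = 0 <;> simp [choiceMatrix, h]

theorem map_genericityProduct {R T : Type*} [CommRing R] [CommRing T] [Fintype ι] (φ : R →+* T)
    (c : ι → Fin n → R) (a : Fin n → R) (v : Fin (n - 2 + 1) → Fin n → R) (r : Fin n → R) :
    φ (genericityProduct c a v r) =
      genericityProduct (fun j => φ ∘ c j) (φ ∘ a) (fun i => φ ∘ v i) (φ ∘ r) := by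
  simp only [genericityProduct, map_mul, map_prod, RingHom.map_det, RingHom.mapMatrix_apply,
    map_choiceMatrix, RingHom.map_dotProduct, apply_ite φ, map_one, map_sub]

theorem isGeneric_of_genericityProduct_ne_zero [Fintype ι] {c : ι → Fin n → L} {a : Fin n → L}
    {v : Fin (n - 2 + 1) → Fin n → L} {r : Fin n → L} (h : genericityProduct c a v r ≠ 0) :
    IsGeneric c a v r := by
  simp only [genericityProduct, mul_ne_zero_iff, Finset.prod_ne_zero_iff, Finset.mem_univ,
    true_imp_iff] at h
  obtain ⟨⟨⟨⟨h1, h2⟩, h3⟩, h4⟩, h5⟩ := h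
  exact ⟨h1, h2, fun i j j' hjj' => by simpa [hjj'] using h3 i j j', h4, h5⟩

/-- Indices of the coordinates of the random choices. -/
abbrev CoinIndex (n : ℕ) : Type := Fin n ⊕ (Fin (n - 2 + 1) × Fin n) ⊕ Fin n

/-- The coordinates of the random choices. -/
def coinVector {R : Type*} (a : Fin n → R) (v : Fin (n - 2 + 1) → Fin n → R) (r : Fin n → R) :
    CoinIndex n → R :=
  Sum.elim a (Sum.elim (fun p => v p.1 p.2) r)

/-- The random choices are determined by their coordinates. -/
def coinsEquiv {K : Type*} (S : Finset K) (n : ℕ) : Coins S n ≃ (CoinIndex n → S) where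
  toFun ω := coinVector ω.1 ω.2.1 ω.2.2
  invFun x := (fun j => x (.inl j), fun i j => x (.inr (.inl (i, j))), fun j => x (.inr (.inr j)))
  left_inv _ := rfl
  right_inv x := by
    funext i
    rcases i with i | i | i <;> rfl

open MvPolynomial in
/-- `genericityProduct` as a polynomial in the coordinates of the random choices. -/
noncomputable def genericityPolynomial [Fintype ι] (c : ι → Fin n → L) :
    MvPolynomial (CoinIndex n) L :=
  genericityProduct (fun j => C ∘ c j) (fun j => X (.inl j)) (fun i j => X (.inr (.inl (i, j))))
    fun j => X (.inr (.inr j))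

theorem eval_genericityPolynomial [Fintype ι] (c : ι → Fin n → L) (a : Fin n → L)
    (v : Fin (n - 2 + 1) → Fin n → L) (r : Fin n → L) :
    MvPolynomial.eval (coinVector a v r) (genericityPolynomial c) = genericityProduct c a v r := by
  rw [genericityPolynomial, map_genericityProduct]
  congr 1 <;> simp [Function.comp_def, coinVector]

theorem exists_choiceMatrix_eq_one {R : Type*} [CommRing R] :
    ∃ (a : Fin n → R) (v : Fin (n - 2 + 1) → Fin n → R), choiceMatrix a v = 1 := by
  refine ⟨fun j => if (j : ℕ) = 0 then 1 else 0, fun i j => if (j : ℕ) = i + 1 then 1 else 0, ?_⟩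
  ext i j
  by_cases h : (i : ℕ) = 0
  · simp [choiceMatrix, h, Matrix.one_apply, Fin.ext_iff, eq_comm]
  · have h' : (i : ℕ) - 1 + 1 = i := by omega
    simp [choiceMatrix, h, Matrix.one_apply, Fin.ext_iff, h', eq_comm]

/-- If all minors at pairs of basis vectors vanished, comparison with a nonzero coordinate `c p`
would give `c' = (c' p / c p) • c`. -/
theorem exists_dotProduct_ne {c c' : Fin n → L} (hc : c ≠ 0) (h : ∀ x : L, c' ≠ x • c) :
    ∃ p q, (c ⬝ᵥ p) * (c' ⬝ᵥ q) - (c ⬝ᵥ q) * (c' ⬝ᵥ p) ≠ 0 := by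
  by_contra! H
  obtain ⟨p, hp⟩ := Function.ne_iff.1 hc
  refine h ((c' p) / c p) (funext fun q => ?_)
  have := H (Pi.single p 1) (Pi.single q 1)
  simp only [dotProduct_single, mul_one] at this
  simp only [Pi.zero_apply] at hp
  rw [Pi.smul_apply, smul_eq_mul]
  field_simp
  linear_combination this

/-- The polynomial ring is a domain, so each factor may be shown nonzero at its own evaluation
point; no common generic point has to be exhibited. The determinant is evaluated at the identity
matrix. -/
theorem genericityPolynomial_ne_zero [Fintype ι] {c : ι → Fin n → L} (hc : ∀ j, c j ≠ 0)
    (hcc : ∀ j j', j ≠ j' → ∀ x : L, c j ≠ x • c j') : genericityPolynomial c ≠ 0 := by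
  have key : ∀ {P : MvPolynomial (CoinIndex n) L} (a : Fin n → L)
      (v : Fin (n - 2 + 1) → Fin n → L) (r : Fin n → L),
      MvPolynomial.eval (coinVector a v r) P ≠ 0 → P ≠ 0 := by
    rintro _ a v r h rfl
    exact h (map_zero _)
  have hc' : ∀ j, ∃ p, c j ⬝ᵥ p ≠ 0 := fun j => by
    obtain ⟨p, hp⟩ := Function.ne_iff.1 (hc j)
    exact ⟨Pi.single p 1, by simpa using hp⟩
  choose p hp using hc'
  simp only [genericityPolynomial, genericityProduct, mul_ne_zero_iff, Finset.prod_ne_zero_iff,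
    Finset.mem_univ, true_imp_iff]
  refine ⟨⟨⟨⟨fun j => key (p j) 0 0 ?_, fun i j => key 0 (fun _ => p j) 0 ?_⟩, fun i j j' => ?_⟩,
    ?_⟩, fun j => key 0 0 (p j) ?_⟩
  · rw [RingHom.map_dotProduct]
    simpa [Function.comp_def, coinVector] using hp j
  · rw [RingHom.map_dotProduct]
    simpa [Function.comp_def, coinVector] using hp j
  · split_ifs with hjj'
    · exact one_ne_zero
    · obtain ⟨x, y, hxy⟩ := exists_dotProduct_ne (hc j) (hcc j' j (Ne.symm hjj'))
      refine key y (fun _ => x) 0 ?_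
      simp only [map_sub, map_mul, RingHom.map_dotProduct]
      simpa [Function.comp_def, coinVector] using hxy
  · obtain ⟨a, v, hav⟩ := exists_choiceMatrix_eq_one (n := n) (R := L)
    refine key a v 0 ?_
    rw [RingHom.map_det, RingHom.mapMatrix_apply, map_choiceMatrix]
    simp [Function.comp_def, coinVector, hav]
  · rw [RingHom.map_dotProduct]
    simpa [Function.comp_def, coinVector] using hp j

theorem totalDegree_det_le {R σ : Type*} [CommRing R] {m : ℕ}
    {M : Matrix (Fin m) (Fin m) (MvPolynomial σ R)} (hM : ∀ i j, (M i j).totalDegree ≤ 1) :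
    M.det.totalDegree ≤ m := by
  rw [Matrix.det_apply]
  refine MvPolynomial.totalDegree_finsetSum_le fun τ _ =>
    (MvPolynomial.totalDegree_smul_le _ _).trans
      ((MvPolynomial.totalDegree_finsetProd _ _).trans ?_)
  exact (Finset.sum_le_sum fun i _ => hM _ _).trans (by simp)

theorem totalDegree_genericityPolynomial_le [Fintype ι] (c : ι → Fin n → L) :
    (genericityPolynomial c).totalDegree ≤
      Fintype.card ι + (n - 2 + 1) * Fintype.card ι +
        (n - 2 + 1) * (Fintype.card ι * (Fintype.card ι * 2)) + n + Fintype.card ι := by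
  have hlin : ∀ (j : ι) (x : Fin n → CoinIndex n),
      ((MvPolynomial.C ∘ c j) ⬝ᵥ fun i => MvPolynomial.X (x i) :
        MvPolynomial (CoinIndex n) L).totalDegree ≤ 1 := fun j x =>
    MvPolynomial.totalDegree_finsetSum_le fun i _ =>
      (MvPolynomial.totalDegree_mul _ _).trans (by simp)
  have hprod : ∀ {κ : Type _} [Fintype κ] {b : ℕ} {P : κ → MvPolynomial (CoinIndex n) L},
      (∀ i, (P i).totalDegree ≤ b) → (∏ i, P i).totalDegree ≤ Fintype.card κ * b :=
    fun h => (MvPolynomial.totalDegree_finsetProd _ _).trans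
      ((Finset.sum_le_sum fun i _ => h i).trans (by simp))
  have hprodFin : ∀ {b : ℕ} {P : Fin (n - 2 + 1) → MvPolynomial (CoinIndex n) L},
      (∀ i, (P i).totalDegree ≤ b) → (∏ i, P i).totalDegree ≤ (n - 2 + 1) * b :=
    fun h => (MvPolynomial.totalDegree_finsetProd _ _).trans
      ((Finset.sum_le_sum fun i _ => h i).trans (by simp))
  have hmul : ∀ {P Q : MvPolynomial (CoinIndex n) L} {b b' : ℕ}, P.totalDegree ≤ b →
      Q.totalDegree ≤ b' → (P * Q).totalDegree ≤ b + b' := fun h h' =>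
    (MvPolynomial.totalDegree_mul _ _).trans (add_le_add h h')
  rw [genericityPolynomial, genericityProduct]
  refine hmul (hmul (hmul (hmul ?_ ?_) ?_) ?_) ?_
  · simpa using hprod fun j => hlin j _
  · exact hprodFin fun i => by simpa using hprod fun j => hlin j _
  · refine hprodFin fun i => hprod fun j => hprod fun j' => ?_
    split_ifs
    · simp
    · exact (MvPolynomial.totalDegree_sub _ _).trans
        (max_le (hmul (hlin _ _) (hlin _ _)) (hmul (hlin _ _) (hlin _ _)))
  · refine totalDegree_det_le fun i j => ?_
    by_cases h : (i : ℕ) = 0 <;> simp [choiceMatrix, h]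
  · simpa using hprod fun j => hlin j _

/-- The bound `N(n, d)`. -/
def failureBound {R : Type*} [CommSemiring R] (n d : R) : R :=
  d + (n + 1) * d + (n + 1) * (d * (d * 2)) + n + d

theorem uniformProb_not_isFactorizationOf_le {K : Type*} [Field K] [CharZero K] [Algebra K L]
    [Fintype ι] {f : MvPolynomial (Fin n) K} {lam : L} {c : ι → Fin n → L} {α : ι → ℕ}
    (hf : MvPolynomial.map (algebraMap K L) f =
      MvPolynomial.C lam * ∏ j, linearForm (c j) ^ α j)
    (hlam : lam ≠ 0) (hα : ∀ j, 1 ≤ α j) {d : ℕ} (hd : ∑ j, α j ≤ d) (hc : ∀ j, c j ≠ 0)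
    (hcc : ∀ j j', j ≠ j' → ∀ x : L, c j ≠ x • c j') (S : Finset K) :
    uniformProb {ω : Coins S n | ¬ (output L d f ω).IsFactorizationOf f} ≤
      (failureBound n d : ℕ) / (S.card : ℝ) := by
  have : CharZero L := charZero_of_injective_algebraMap (algebraMap K L).injective
  -- Every exponent is at least 1, so there are at most as many forms as the sum of the exponents.
  have hcard : Fintype.card ι ≤ d := by
    refine le_trans ?_ hd
    simpa using Finset.sum_le_sum fun j (_ : j ∈ Finset.univ) => hα j
  refine (uniformProb_le_of_equiv (coinsEquiv S n) (E' := {x |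
    MvPolynomial.eval (fun i => algebraMap K L (x i)) (genericityPolynomial c) = 0}) ?_).trans
    ((uniformProb_eval_eq_zero_le (genericityPolynomial_ne_zero hc hcc) S).trans ?_)
  · intro ω hω
    by_contra hne
    refine hω (IsGeneric.isFactorizationOf_run_algorithm
      (isGeneric_of_genericityProduct_ne_zero ?_) hf hlam hα hd)
    have hcoin : (fun i => algebraMap K L (coinsEquiv S n ω i)) =
        coinVector (fun j => algebraMap K L (ω.1 j)) (fun i j => algebraMap K L (ω.2.1 i j))
          fun j => algebraMap K L (ω.2.2 j) := by
      funext i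
      rcases i with i | i | i <;> rfl
    rw [← eval_genericityPolynomial, ← hcoin]
    exact hne
  · gcongr
    refine (totalDegree_genericityPolynomial_le c).trans ?_
    -- Truncated subtraction is not polynomial in `n`, hence the coarser `n + 1` in `failureBound`.
    have h1 : n - 2 + 1 ≤ n + 1 := by omega
    simp only [failureBound]
    gcongr

end HyperplaneAlgorithm

/-! ### Bit sizes of rational numbers under arithmetic. -/

section BitSize

/-- The rational number `q` is a fraction whose numerator and denominator are at most `2 ^ b` in
absolute value. -/
def HasBits (b : ℕ) (q : ℚ) : Prop :=
  ∃ (x : ℤ) (y : ℕ), y ≠ 0 ∧ q = x / y ∧ x.natAbs ≤ 2 ^ b ∧ y ≤ 2 ^ b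

theorem hasBits_of_ratBitSize_le {q : ℚ} {s : ℕ} (h : ratBitSize q ≤ s) : HasBits s q := by
  refine ⟨q.num, q.den, q.den_nz, (Rat.num_div_den q).symm, ?_, ?_⟩
  · refine (Nat.lt_size_self _).le.trans (Nat.pow_le_pow_right two_pos ?_)
    unfold ratBitSize at h; omega
  · refine (Nat.lt_size_self _).le.trans (Nat.pow_le_pow_right two_pos ?_)
    unfold ratBitSize at h; omega

/-- Passing to lowest terms only shrinks numerator and denominator. A number at most `2 ^ b` has at
most `b + 1` digits; two such numbers and the sign give `2 * b + 3`. -/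
theorem HasBits.ratBitSize_le {q : ℚ} {b : ℕ} (h : HasBits b q) : ratBitSize q ≤ 2 * b + 3 := by
  obtain ⟨x, y, hy, rfl, hx, hy'⟩ := h
  have hsize : ∀ {m : ℕ}, m ≤ 2 ^ b → m.size ≤ b + 1 := fun hm =>
    Nat.size_le.2 (hm.trans_lt (Nat.pow_lt_pow_right one_lt_two (Nat.lt_succ_self b)))
  have hy0 : (y : ℤ) ≠ 0 := by exact_mod_cast hy
  have hden : ((x / y : ℚ)).den ≤ y := by
    refine Nat.le_of_dvd (Nat.pos_of_ne_zero hy) ?_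
    have := Rat.den_dvd x y
    rw [Rat.divInt_eq_div] at this
    exact_mod_cast this
  have hnum : ((x / y : ℚ)).num.natAbs ≤ x.natAbs := by
    rcases eq_or_ne x 0 with rfl | hx0
    · simp
    · refine Nat.le_of_dvd (Int.natAbs_pos.2 hx0) (Int.natAbs_dvd_natAbs.2 ?_)
      have := Rat.num_dvd x hy0
      rw [Rat.divInt_eq_div] at this
      exact_mod_cast this
  have h1 := hsize (hnum.trans hx)
  have h2 := hsize (hden.trans hy')
  unfold ratBitSize
  omega

theorem HasBits.mono {q : ℚ} {b b' : ℕ} (h : HasBits b q) (hb : b ≤ b') : HasBits b' q := by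
  obtain ⟨x, y, hy, hq, hx, hy'⟩ := h
  have : 2 ^ b ≤ 2 ^ b' := Nat.pow_le_pow_right two_pos hb
  exact ⟨x, y, hy, hq, hx.trans this, hy'.trans this⟩

theorem hasBits_intCast {x : ℤ} {b : ℕ} (h : x.natAbs ≤ 2 ^ b) : HasBits b (x : ℚ) :=
  ⟨x, 1, one_ne_zero, by simp, h, Nat.one_le_two_pow⟩

theorem hasBits_natCast {m b : ℕ} (h : m ≤ 2 ^ b) : HasBits b (m : ℚ) := by
  simpa using hasBits_intCast (x := m) (b := b) (by simpa using h)

theorem HasBits.mul {p q : ℚ} {b b' : ℕ} (hp : HasBits b p) (hq : HasBits b' q) :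
    HasBits (b + b') (p * q) := by
  obtain ⟨x, y, hy, rfl, hx, hy'⟩ := hp
  obtain ⟨z, w, hw, rfl, hz, hw'⟩ := hq
  refine ⟨x * z, y * w, mul_ne_zero hy hw, by push_cast; rw [div_mul_div_comm], ?_, ?_⟩
  · rw [Int.natAbs_mul, pow_add]
    exact Nat.mul_le_mul hx hz
  · rw [pow_add]
    exact Nat.mul_le_mul hy' hw'

theorem HasBits.neg {p : ℚ} {b : ℕ} (hp : HasBits b p) : HasBits b (-p) := by
  obtain ⟨x, y, hy, rfl, hx, hy'⟩ := hp
  exact ⟨-x, y, hy, by push_cast; rw [neg_div], by simpa using hx, hy'⟩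

theorem HasBits.inv {p : ℚ} {b : ℕ} (hp : HasBits b p) : HasBits b p⁻¹ := by
  obtain ⟨x, y, hy, rfl, hx, hy'⟩ := hp
  rcases eq_or_ne x 0 with rfl | hx0
  · exact ⟨0, 1, one_ne_zero, by simp, by simp, Nat.one_le_two_pow⟩
  · obtain ⟨m, rfl | rfl⟩ := x.eq_nat_or_neg
    · exact ⟨y, m, by simpa using hx0, by simp, by simpa using hy', by simpa using hx⟩
    · exact ⟨-y, m, by simpa using hx0, by simp [inv_div, neg_div], by simpa using hy',
        by simpa using hx⟩

theorem HasBits.add {p q : ℚ} {b b' : ℕ} (hp : HasBits b p) (hq : HasBits b' q) :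
    HasBits (b + b' + 1) (p + q) := by
  obtain ⟨x, y, hy, rfl, hx, hy'⟩ := hp
  obtain ⟨z, w, hw, rfl, hz, hw'⟩ := hq
  refine ⟨x * w + y * z, y * w, mul_ne_zero hy hw, ?_, ?_, ?_⟩
  · have : (y : ℚ) ≠ 0 := by exact_mod_cast hy
    have : (w : ℚ) ≠ 0 := by exact_mod_cast hw
    push_cast
    field_simp
  · refine (Int.natAbs_add_le _ _).trans ?_
    rw [Int.natAbs_mul, Int.natAbs_mul, Int.natAbs_natCast, Int.natAbs_natCast, pow_succ, mul_two,
      pow_add]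
    exact add_le_add (Nat.mul_le_mul hx hw') (Nat.mul_le_mul hy' hz)
  · refine (Nat.mul_le_mul hy' hw').trans ?_
    rw [← pow_add]
    exact Nat.pow_le_pow_right two_pos (Nat.le_succ _)

theorem hasBits_sum {n b : ℕ} {x : Fin n → ℚ} (h : ∀ j, HasBits b (x j)) :
    HasBits (n * (b + 1)) (∑ j, x j) := by
  induction n with
  | zero => simpa using hasBits_natCast (m := 0) (b := 0) (by simp)
  | succ n ih =>
    rw [Fin.sum_univ_succ]
    exact ((h 0).add (ih fun j => h j.succ)).mono (by linarith)

theorem hasBits_dotProduct {n b b' : ℕ} {x y : Fin n → ℚ} (hx : ∀ j, HasBits b (x j))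
    (hy : ∀ j, HasBits b' (y j)) : HasBits (n * (b + b' + 1)) (x ⬝ᵥ y) :=
  hasBits_sum fun j => (hx j).mul (hy j)

theorem hasBits_add_smul {n b b' : ℕ} {p q : Fin n → ℚ} {t : ℚ} (hp : ∀ j, HasBits b (p j))
    (hq : ∀ j, HasBits b (q j)) (ht : HasBits b' t) (j : Fin n) :
    HasBits (b + (b' + b) + 1) ((p + t • q) j) :=
  (hp j).add (ht.mul (hq j))

theorem pointBitSize_le {n b : ℕ} {q : Fin n → ℚ} (h : ∀ j, HasBits b (q j)) :
    pointBitSize q ≤ n * (2 * b + 3) := by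
  refine (Finset.sum_le_sum fun j _ => (h j).ratBitSize_le).trans ?_
  simp

/-- Bounding `N` by `2 ^ N` is wasteful, but keeps the number of bits polynomial in `N`, with only
the digits of `m` entering. -/
theorem hasBits_of_mem_ratInterval {m N : ℕ} {q : ℚ} (h : q ∈ ratInterval (m * N)) :
    HasBits (m.size + N) q := by
  obtain ⟨i, hi, rfl⟩ := Finset.mem_image.1 h
  refine hasBits_natCast ((Nat.lt_succ_iff.1 (Finset.mem_range.1 hi)).trans ?_)
  rw [pow_add]
  exact Nat.mul_le_mul (Nat.lt_size_self m).le Nat.lt_two_pow_self.le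

end BitSize

/-! ### Number and size of the calls, for all random choices. -/

namespace HyperplaneAlgorithm

open BlackBox Polynomial

theorem numRoots_le_natDegree {L : Type*} [Field L] (g : L[X]) : numRoots g ≤ g.natDegree := by
  classical
  rw [numRoots]
  convert! (Multiset.toFinset_card_le _).trans (card_roots' g)

section Queries

variable {L : Type*} [Field L] [CharZero L] {n : ℕ} {ι : Type*} [Fintype ι]
  {o : (Fin n → L) → L} {lam : L} {c : ι → Fin n → L} {α : ι → ℕ} {d : ℕ}

/-- The bound `P(n, d)`. -/
def callBound {R : Type*} [CommSemiring R] (n d : R) : R :=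
  (n + 1) * (d + 1) + ((n + 1) * d * ((n + 1) * d * d) + 1)

theorem length_calls_algorithm_le (ho : ∀ x, o x = lam * ∏ j, (c j ⬝ᵥ x) ^ α j)
    (hd : ∑ j, α j ≤ d) (a : Fin n → L) (v : Fin (n - 2 + 1) → Fin n → L) (r : Fin n → L) :
    ((algorithm d a v r).calls o).length ≤ callBound n d := by
  have hdeg : ∀ i, (lineProduct lam c α a (v i)).natDegree ≤ d := fun i =>
    (natDegree_lineProduct_le _ _ _ _ _).trans hd
  have hlen : (intersectionPoints a v fun i => lineProduct lam c α a (v i)).length ≤ (n + 1) * d :=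
    (length_intersectionPoints_le hdeg).trans (Nat.mul_le_mul_right _ (by omega))
  have hk : numRoots (lineProduct lam c α a (v 0)) - 1 ≤ d :=
    (Nat.sub_le _ _).trans ((numRoots_le_natDegree _).trans (hdeg 0))
  rw [calls_algorithm]
  simp only [run_interpolateLine_eq_lineProduct ho hd, List.length_append, List.length_flatMap,
    calls_interpolateLine, List.length_map, List.length_finRange, List.map_const',
    List.sum_replicate, smul_eq_mul, List.length_singleton, callBound]
  gcongr ?_ * (d + 1) + (?_ + 1)
  · omega
  · refine (length_calls_groupPoints_le _ _ _ _).trans ?_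
    gcongr

end Queries

section RationalQueries

variable {L : Type*} [Field L] [Algebra ℚ L] {n : ℕ}

/-- The point of `Lⁿ` with the given rational coordinates. -/
def ratPoint (L : Type*) [Field L] [Algebra ℚ L] (q : Fin n → ℚ) : Fin n → L :=
  fun j => algebraMap ℚ L (q j)

theorem ratPoint_add_smul (p q : Fin n → ℚ) (t : ℚ) :
    ratPoint L (p + t • q) = ratPoint L p + algebraMap ℚ L t • ratPoint L q := by
  funext j
  simp only [ratPoint, Pi.add_apply, Pi.smul_apply, smul_eq_mul, map_add, map_mul]

theorem ratPoint_dotProduct (p q : Fin n → ℚ) :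
    ratPoint L p ⬝ᵥ ratPoint L q = algebraMap ℚ L (p ⬝ᵥ q) :=
  (RingHom.map_dotProduct _ _ _).symm

/-- The point `x` has rational coordinates of at most `b` bits each. -/
def HasRatBits (b : ℕ) (x : Fin n → L) : Prop :=
  ∃ q : Fin n → ℚ, x = ratPoint L q ∧ ∀ j, HasBits b (q j)

theorem HasRatBits.mono {b b' : ℕ} {x : Fin n → L} (hx : HasRatBits b x) (h : b ≤ b') :
    HasRatBits b' x := by
  obtain ⟨q, rfl, hq⟩ := hx
  exact ⟨q, rfl, fun j => (hq j).mono h⟩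

theorem HasRatBits.add_smul {b b' : ℕ} {x y : Fin n → L} {t : ℚ} (hx : HasRatBits b x)
    (hy : HasRatBits b y) (ht : HasBits b' t) :
    HasRatBits (b + (b' + b) + 1) (x + algebraMap ℚ L t • y) := by
  obtain ⟨p, rfl, hp⟩ := hx
  obtain ⟨q, rfl, hq⟩ := hy
  exact ⟨p + t • q, (ratPoint_add_smul p q t).symm, hasBits_add_smul hp hq ht⟩

/-- The bound for the coordinates of the intersection points. -/
def meetBits {R : Type*} [CommSemiring R] (n s b : R) : R :=
  b + (n * (s + b + 1) + n * (s + b + 1) + b) + 1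

/-- The bound for the coordinates of all points at which the black box is called. -/
def queryBits {R : Type*} [CommSemiring R] (n d s b : R) : R :=
  d + meetBits n s b + (d + meetBits n s b) + d + 1

variable {ι : Type*} [Fintype ι] {o : (Fin n → L) → L} {lam : L} {c : ι → Fin n → ℚ} {α : ι → ℕ}
  {d s b : ℕ}

/-- Each root is minus a quotient of two values of one rational form at points of bounded size, even
for degenerate choices. -/
theorem hasRatBits_of_mem_intersectionPoints (hc : ∀ i j, HasBits s (c i j)) {a : Fin n → L}
    {v : Fin (n - 2 + 1) → Fin n → L} (ha : HasRatBits b a) (hv : ∀ i, HasRatBits b (v i))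
    {p : Fin n → L}
    (hp : p ∈ intersectionPoints a v fun i =>
      lineProduct lam (fun j => ratPoint L (c j)) α a (v i)) :
    HasRatBits (meetBits n s b) p := by
  obtain ⟨i, t, ht, rfl⟩ := mem_intersectionPoints.1 hp
  obtain ⟨j, -, -, rfl⟩ := exists_of_mem_roots_lineProduct ht
  obtain ⟨a', ha', hab⟩ := id ha
  obtain ⟨v', hv', hvb⟩ := id (hv i)
  have ht : -((ratPoint L (c j) ⬝ᵥ v i)⁻¹ * (ratPoint L (c j) ⬝ᵥ a)) =
      algebraMap ℚ L (-((c j ⬝ᵥ v')⁻¹ * (c j ⬝ᵥ a'))) := by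
    rw [ha', hv', ratPoint_dotProduct, ratPoint_dotProduct, map_neg, map_mul, map_inv₀]
  rw [ht]
  exact ha.add_smul (hv i)
    ((hasBits_dotProduct (hc j) hvb).inv.mul (hasBits_dotProduct (hc j) hab)).neg

theorem hasRatBits_of_mem_calls_algorithm [CharZero L]
    (ho : ∀ x, o x = lam * ∏ j, (ratPoint L (c j) ⬝ᵥ x) ^ α j) (hd : ∑ j, α j ≤ d)
    (hc : ∀ i j, HasBits s (c i j)) {a : Fin n → L} {v : Fin (n - 2 + 1) → Fin n → L}
    {r : Fin n → L} (ha : HasRatBits b a) (hv : ∀ i, HasRatBits b (v i)) (hr : HasRatBits b r)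
    {x : Fin n → L} (hx : x ∈ (algorithm d a v r).calls o) :
    HasRatBits (queryBits n d s b) x := by
  have hbits : ∀ {i : ℕ}, i ≤ d → HasBits d (i : ℚ) := fun hi =>
    hasBits_natCast (hi.trans Nat.lt_two_pow_self.le)
  have hmb : b + b + 1 ≤ meetBits n s b := by simp only [meetBits]; omega
  rw [calls_algorithm] at hx
  simp only [run_interpolateLine_eq_lineProduct ho hd, List.mem_append, List.mem_flatMap,
    calls_interpolateLine, List.mem_map, List.mem_singleton] at hx
  rcases hx with ⟨i, -, k, -, rfl⟩ | hx | rfl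
  · have := ha.add_smul (hv i) (hbits (Nat.lt_succ_iff.1 k.2))
    rw [map_natCast] at this
    exact this.mono (by simp only [queryBits]; omega)
  · obtain ⟨p, hp, q, hq, hx⟩ := exists_of_mem_calls_groupPoints _ _ _ _ hx
    rw [calls_lineTest] at hx
    obtain ⟨k, -, rfl⟩ := List.mem_map.1 hx
    obtain ⟨p', rfl, hp'⟩ := hasRatBits_of_mem_intersectionPoints hc ha hv hp
    obtain ⟨q', rfl, hq'⟩ := hasRatBits_of_mem_intersectionPoints hc ha hv hq
    -- The largest test parameter is the number of distinct roots on the first line, at most the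
    -- degree.
    have hk : (k : ℕ) + 2 ≤ d := by
      have h1 := (numRoots_le_natDegree _).trans
        ((natDegree_lineProduct_le lam (fun j => ratPoint L (c j)) α a (v 0)).trans hd)
      have := k.2
      omega
    have hk' : HasBits d (1 - (((k : ℕ) + 2 : ℕ) : ℚ)) := by
      have : (1 - (((k : ℕ) + 2 : ℕ) : ℚ)) = ((-((k : ℕ) + 1 : ℤ) : ℤ) : ℚ) := by
        push_cast; ring
      rw [this]
      refine hasBits_intCast (le_trans ?_ Nat.lt_two_pow_self.le)
      omega
    refine ⟨(((k : ℕ) + 2 : ℕ) : ℚ) • p' + (1 - (((k : ℕ) + 2 : ℕ) : ℚ)) • q', ?_, fun j => ?_⟩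
    · funext j
      simp [ratPoint]
    · refine (((hbits hk).mul (hp' j)).add (hk'.mul (hq' j))).mono ?_
      simp only [queryBits]
      omega
  · exact hr.mono (by simp only [queryBits]; omega)

end RationalQueries

end HyperplaneAlgorithm

/-! ### Indexed forms and exponents of a given factorization. -/

namespace LinearFactorization

variable {K L : Type*} [Field K] [Field L] [Algebra K L] {n : ℕ} {f : MvPolynomial (Fin n) K}

/-- The form with index `j` of a factorization. -/
def form (F : LinearFactorization n L) (j : Fin F.factors.length) : Fin n → L := (F.factors.get j).1

/-- The exponent with index `j` of a factorization. -/
def exponent (F : LinearFactorization n L) (j : Fin F.factors.length) : ℕ := (F.factors.get j).2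

namespace IsFactorizationOf

variable {F : LinearFactorization n L}

theorem form_ne_zero (hF : F.IsFactorizationOf f) (j : Fin F.factors.length) : F.form j ≠ 0 :=
  (hF.1 _ (List.get_mem _ _)).1

theorem one_le_exponent (hF : F.IsFactorizationOf f) (j : Fin F.factors.length) :
    1 ≤ F.exponent j :=
  (hF.1 _ (List.get_mem _ _)).2

theorem form_ne_smul (hF : F.IsFactorizationOf f) {j j' : Fin F.factors.length} (h : j ≠ j')
    (x : L) : F.form j ≠ x • F.form j' := by
  have hpw := List.pairwise_iff_get.1 hF.2.1
  rcases lt_or_gt_of_ne h with h | h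
  · exact hpw _ _ h x
  -- The pairwise condition only compares earlier with later forms; the other order follows by
  -- inverting the scalar.
  · intro hx
    have hx0 : x ≠ 0 := by
      rintro rfl
      exact hF.form_ne_zero j (by rw [hx, zero_smul])
    exact hpw _ _ h x⁻¹ (by
      change F.form j' = x⁻¹ • F.form j
      rw [hx, inv_smul_smul₀ hx0])

theorem map_eq (hF : F.IsFactorizationOf f) :
    MvPolynomial.map (algebraMap K L) f =
      MvPolynomial.C F.constant * ∏ j, linearForm (F.form j) ^ F.exponent j := by
  rw [hF.2.2, ← List.prod_ofFn]
  congr 2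
  refine List.ext_getElem (by simp) fun i h1 h2 => ?_
  simp [form, exponent]

theorem constant_ne_zero (hF : F.IsFactorizationOf f) (hf : f ≠ 0) : F.constant ≠ 0 := by
  intro h
  have := hF.map_eq
  rw [h, map_zero, zero_mul] at this
  exact hf ((MvPolynomial.map_injective _ (algebraMap K L).injective) (by rw [this, map_zero]))

/-- The product is homogeneous of degree the sum of the exponents, and extension of scalars
preserves the support. -/
theorem sum_exponent_le (hF : F.IsFactorizationOf f) (hf : f ≠ 0) :
    ∑ j, F.exponent j ≤ f.totalDegree := by
  have hinj := (algebraMap K L).injective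
  have hne : MvPolynomial.map (algebraMap K L) f ≠ 0 := fun h =>
    hf (MvPolynomial.map_injective _ hinj (by rw [h, map_zero]))
  have hhom : (MvPolynomial.map (algebraMap K L) f).IsHomogeneous (∑ j, F.exponent j) := by
    rw [hF.map_eq, ← zero_add (∑ j, F.exponent j)]
    refine (MvPolynomial.isHomogeneous_C _ _).mul
      (MvPolynomial.IsHomogeneous.prod _ _ _ fun j _ => ?_)
    simpa using (isHomogeneous_linearForm (F.form j)).pow (F.exponent j)
  rw [← hhom.totalDegree hne, MvPolynomial.totalDegree, MvPolynomial.totalDegree,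
    MvPolynomial.support_map_of_injective _ hinj]

end IsFactorizationOf

end LinearFactorization

/-! ### Rational forms after extension of scalars. -/

namespace HyperplaneAlgorithm

variable {L : Type*} [Field L] {n : ℕ}

variable [Algebra ℚ L]

theorem map_linearForm (c : Fin n → ℚ) :
    MvPolynomial.map (algebraMap ℚ L) (linearForm c) = linearForm (ratPoint L c) := by
  simp only [linearForm, ratPoint, map_sum, map_mul, MvPolynomial.map_C, MvPolynomial.map_X]

theorem ratPoint_ne_zero {c : Fin n → ℚ} (hc : c ≠ 0) : ratPoint L c ≠ 0 := fun h =>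
  hc <| funext fun j => (map_eq_zero (algebraMap ℚ L)).1 (congrFun h j)

/-- A scalar in `L` relating two rational vectors is a quotient of coordinates, hence already
rational. -/
theorem ratPoint_ne_smul {c c' : Fin n → ℚ} (hc : c' ≠ 0) (h : ∀ x : ℚ, c ≠ x • c') (x : L) :
    ratPoint L c ≠ x • ratPoint L c' := by
  intro hx
  obtain ⟨j, hj⟩ := Function.ne_iff.1 hc
  have hj' : algebraMap ℚ L (c' j) ≠ 0 := fun h0 => hj ((map_eq_zero _).1 h0)
  have hxj : algebraMap ℚ L (c j) = x * algebraMap ℚ L (c' j) := congrFun hx j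
  have hx' : x = algebraMap ℚ L (c j / c' j) := by
    rw [map_div₀, hxj, mul_div_cancel_right₀ _ hj']
  refine h (c j / c' j) (funext fun i => (algebraMap ℚ L).injective ?_)
  rw [Pi.smul_apply, smul_eq_mul, map_mul, ← hx']
  exact congrFun hx i

end HyperplaneAlgorithm

/-! ### The theorem. -/

open HyperplaneAlgorithm in
theorem mainTheorem8 :
    ∃ (N P : MvPolynomial (Fin 2) ℕ) (B : MvPolynomial (Fin 4) ℕ),
      (∀ (K : Type*) [Field K] [CharZero K] (L : Type*) [Field L] [Algebra K L] [IsAlgClosure K L]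
        (n d : ℕ) (f : MvPolynomial (Fin n) K), f ≠ 0 → f.totalDegree = d →
        (∃ F : LinearFactorization n L, F.IsFactorizationOf f) →
        ∀ S : Finset K, S.Nonempty →
          uniformProb {ω : HyperplaneAlgorithm.Coins S n |
              ¬ (HyperplaneAlgorithm.output L d f ω).IsFactorizationOf f} ≤
            (MvPolynomial.eval ![n, d] N : ℝ) / (S.card : ℝ) ∧
          ∀ ω : HyperplaneAlgorithm.Coins S n,
            (HyperplaneAlgorithm.queries L d f ω).length ≤ MvPolynomial.eval ![n, d] P) ∧
      (∀ (L : Type*) [Field L] [Algebra ℚ L] [IsAlgClosure ℚ L]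
        (n d s : ℕ) (f : MvPolynomial (Fin n) ℚ), f ≠ 0 → f.totalDegree = d →
        (∃ F : LinearFactorization n ℚ, F.IsFactorizationOf f ∧
          ∀ p ∈ F.factors, ∀ j, ratBitSize (p.1 j) ≤ s) →
        ∀ m : ℕ, 1 ≤ m →
          uniformProb {ω : HyperplaneAlgorithm.Coins
              (ratInterval (m * MvPolynomial.eval ![n, d] N)) n |
              ¬ (HyperplaneAlgorithm.output L d f ω).IsFactorizationOf f} ≤ 1 / (m : ℝ) ∧
          ∀ ω : HyperplaneAlgorithm.Coins (ratInterval (m * MvPolynomial.eval ![n, d] N)) n,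
            ∀ x ∈ HyperplaneAlgorithm.queries L d f ω,
              ∃ q : Fin n → ℚ, (x = fun j => algebraMap ℚ L (q j)) ∧
                pointBitSize q ≤ MvPolynomial.eval ![n, d, s, Nat.size m] B) := by
  have hN : ∀ n d : ℕ, MvPolynomial.eval ![n, d]
      (failureBound (MvPolynomial.X 0) (MvPolynomial.X 1)) = failureBound n d := fun n d => by
    simp [failureBound]
  -- The bounds make sense in any commutative semiring: at the variables they are the required
  -- polynomials, at natural numbers their values. In the third, random coordinates have `m.size +
  -- N` bits, and each of the `n` coordinates of a call costs `2 * b + 3`.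
  refine ⟨failureBound (.X 0) (.X 1), callBound (.X 0) (.X 1),
    .X 0 * (2 * queryBits (.X 0) (.X 1) (.X 2) (.X 3 + failureBound (.X 0) (.X 1)) + 3), ?_, ?_⟩
  · rintro K _ _ L _ _ _ n d f hf rfl ⟨F, hF⟩ S hS
    have : CharZero L := charZero_of_injective_algebraMap (algebraMap K L).injective
    rw [hN]
    refine ⟨uniformProb_not_isFactorizationOf_le hF.map_eq (hF.constant_ne_zero hf)
      hF.one_le_exponent (hF.sum_exponent_le hf) hF.form_ne_zero (fun _ _ => hF.form_ne_smul) S,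
      fun ω => ?_⟩
    refine (length_calls_algorithm_le (aeval_eq_of_map_eq hF.map_eq) (hF.sum_exponent_le hf)
      _ _ _).trans (le_of_eq ?_)
    simp [callBound]
  · rintro L _ _ _ n d s f hf rfl ⟨F, hF, hs⟩ m hm
    have : CharZero L := charZero_of_injective_algebraMap (algebraMap ℚ L).injective
    have hmap : MvPolynomial.map (algebraMap ℚ L) f = MvPolynomial.C (algebraMap ℚ L F.constant) *
        ∏ j, linearForm (ratPoint L (F.form j)) ^ F.exponent j := by
      have h := hF.map_eq
      rw [Algebra.algebraMap_self, MvPolynomial.map_id] at h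
      conv_lhs => rw [show f = _ from h]
      simp only [map_mul, map_prod, map_pow, MvPolynomial.map_C, map_linearForm]
    rw [hN]
    refine ⟨?_, fun ω x hx => ?_⟩
    · refine (uniformProb_not_isFactorizationOf_le hmap
        ((map_ne_zero (algebraMap ℚ L)).2 (hF.constant_ne_zero hf)) hF.one_le_exponent
        (hF.sum_exponent_le hf) (fun j => ratPoint_ne_zero (hF.form_ne_zero j))
        (fun j j' h => ratPoint_ne_smul (hF.form_ne_zero j') (hF.form_ne_smul h)) _).trans ?_
      have hm' : (0 : ℝ) < m := by exact_mod_cast hm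
      -- Here `S` has `m * N + 1` elements, and `N / (m * N + 1) ≤ 1 / m`, also when `N = 0`.
      rw [ratInterval, Finset.card_image_of_injective _ Nat.cast_injective, Finset.card_range,
        div_le_div_iff₀ (by positivity) hm']
      push_cast
      linarith
    · have hcoin : ∀ y : Fin n → ratInterval (m * failureBound n f.totalDegree),
          HasRatBits (m.size + failureBound n f.totalDegree) fun j => algebraMap ℚ L (y j) :=
        fun y => ⟨fun j => y j, rfl, fun j => hasBits_of_mem_ratInterval (y j).2⟩
      obtain ⟨q, rfl, hq⟩ := hasRatBits_of_mem_calls_algorithm (aeval_eq_of_map_eq hmap)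
        (hF.sum_exponent_le hf)
        (fun i j => hasBits_of_ratBitSize_le (hs _ (List.get_mem F.factors i) j))
        (hcoin ω.1) (fun i => hcoin (ω.2.1 i)) (hcoin ω.2.2) hx
      refine ⟨q, rfl, (pointBitSize_le hq).trans (le_of_eq ?_)⟩
      simp [queryBits, meetBits, failureBound]
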